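/- Let $k\ge 6$ be an integer. For $p,q\ge 0$ identify $\odot^{p}\mathbb C^4\otimes\wedge^{q}\mathbb C^4$ with the space of complex tuples $f=(f^{A_1\ldots A_q}_{B_1\ldots B_p})$, indices in $\{1,2,3,4\}$, that are symmetric in $B_1,\ldots,B_p$ and antisymmetric in $A_1,\ldots,A_q$. For $p,q\ge 1$ the contraction $\mathscr C:\odot^{p}\mathbb C^4\otimes\wedge^{q}\mathbb C^4\to\odot^{p-1}\mathbb C^4\otimes\wedge^{q-1}\mathbb C^4$ is $$\mathscr C(f)^{A_1\ldots A_{q-1}}_{B_1\ldots B_{p-1}}=\sum_{C=1}^4 f^{CA_1\ldots A_{q-1}}_{B_1\ldots B_{p-1}C}.$$ Put $\mathscr V_0=\odot^{k}\mathbb C^4$ and, for $l=1,2,3$, $\mathscr V_l=\ker\bigl(\mathscr C|_{\odot^{k-l}\mathbb C^4\otimes\wedge^l\mathbb C^4}\bigr)$. Let $x=(x^0,\ldots,x^5)$ be the coordinates of $\mathbb R^6$, write $\partial_j=\partial_{x^j}$, and let $$(\nabla^{AB})=\begin{pmatrix}0&i\partial_0+\partial_5&\partial_3+i\partial_4&\partial_1+i\partial_2\\-i\partial_0-\partial_5&0&\partial_1-i\partial_2&-\partial_3+i\partial_4\\-\partial_3-i\partial_4&-\partial_1+i\partial_2&0&-i\partial_0+\partial_5\\-\partial_1-i\partial_2&\partial_3-i\partial_4&i\partial_0-\partial_5&0\end{pmatrix}.$$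 For $l=0,1,2$ and a smooth $\mathscr V_l$-valued function $f$ on $\mathbb R^6$, let $$(\mathscr D_lf)^{A_1\ldots A_{l+1}}_{B_2\ldots B_{k-l}}=\frac1{(l+1)!}\sum_{\sigma\in S_{l+1}}\operatorname{sgn}(\sigma)\sum_{B_1=1}^4\nabla^{B_1A_{\sigma(1)}}f^{A_{\sigma(2)}\ldots A_{\sigma(l+1)}}_{B_1B_2\ldots B_{k-l}},$$ which is $\mathscr V_{l+1}$-valued. Let $P(\mathbb R^6,\mathscr V_l)$ be the space of $\mathscr V_l$-valued functions on $\mathbb R^6$ whose components are polynomials in $x^0,\ldots,x^5$ with complex coefficients. **Theorem.** For every integer $k\ge 6$ the sequence $$P(\mathbb R^6,\mathscr V_0)\xrightarrow{\mathscr D_0}P(\mathbb R^6,\mathscr V_1)\xrightarrow{\mathscr D_1}P(\mathbb R^6,\mathscr V_2)\xrightarrow{\mathscr D_2}P(\mathbb R^6,\mathscr V_3)\longrightarrow 0$$ is exact: the kernel of $\mathscr D_1$ is the image of $\mathscr D_0$, the kernel of $\mathscr D_2$ is the image of $\mathscr D_1$, and $\mathscr D_2$ is surjective. -/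

import Mathlib

/-!
# The `k`-monogenic complex on `ℝ⁶` and its polynomial version
-/

noncomputable section

namespace KMonogenic

/-- Euclidean space `ℝ⁶` with coordinates `x⁰, …, x⁵`. -/
abbrev E6 : Type := EuclideanSpace ℝ (Fin 6)

/-- Tensors `f = (f^{A₁…A_q}_{B₁…B_p})` with `q` upper and `p` lower indices, each of which takes
four values; `f A B` is the component with upper indices `A` and lower indices `B`. -/
abbrev Tensor (p q : ℕ) : Type := (Fin q → Fin 4) → (Fin p → Fin 4) → ℂ

/-- `V = ⊙^p ℂ⁴ ⊗ ∧^q ℂ⁴`: tensors that are symmetric in the `p` lower indices and antisymmetric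
in the `q` upper indices. -/
def symAlt (p q : ℕ) : Submodule ℂ (Tensor p q) where
  carrier := {f |
    (∀ A B (τ : Equiv.Perm (Fin p)), f A (fun i => B (τ i)) = f A B) ∧
    (∀ A B (σ : Equiv.Perm (Fin q)),
      f (fun i => A (σ i)) B = ((Equiv.Perm.sign σ : ℤ) : ℂ) * f A B)}
  add_mem' := by
    rintro f g ⟨hf, hf'⟩ ⟨hg, hg'⟩
    refine ⟨fun A B τ => ?_, fun A B σ => ?_⟩
    · simp [hf, hg]
    · simp [hf', hg', mul_add]
  zero_mem' := by simp
  smul_mem' := by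
    rintro c f ⟨hf, hf'⟩
    refine ⟨fun A B τ => ?_, fun A B σ => ?_⟩
    · simp [hf]
    · simp [hf', mul_left_comm]

/-- The contraction `𝒞(f)^{A₁…A_q}_{B₁…B_p} = ∑_C f^{C A₁…A_q}_{B₁…B_p C}`. -/
def contraction (p q : ℕ) : Tensor (p + 1) (q + 1) →ₗ[ℂ] Tensor p q where
  toFun f := fun A B => ∑ C : Fin 4, f (Fin.cons C A) (Fin.snoc B C)
  map_add' f g := by
    funext A B
    simp [Finset.sum_add_distrib]
  map_smul' c f := by
    funext A B
    simp [Finset.mul_sum]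

/-- `𝒱 = ker 𝒞` inside `V = ⊙^p ℂ⁴ ⊗ ∧^q ℂ⁴`. If `p = 0` or `q = 0` there is nothing to contract,
the contraction is zero and `𝒱 = V`. The space written `𝒱_l` for a given `k` is
`calV (k - l) l`. -/
def calV : (p q : ℕ) → Submodule ℂ (Tensor p q)
  | p + 1, q + 1 => symAlt (p + 1) (q + 1) ⊓ LinearMap.ker (contraction p q)
  | 0, q => symAlt 0 q
  | p + 1, 0 => symAlt (p + 1) 0

/-- The embedding `ι` of `ℝ⁶` in the antisymmetric complex `4 × 4` matrices, extended
complex-linearly to `ℂ⁶`. -/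
def iota (z : Fin 6 → ℂ) : Matrix (Fin 4) (Fin 4) ℂ :=
  !![0, Complex.I * z 0 + z 5, z 3 + Complex.I * z 4, z 1 + Complex.I * z 2;
    -Complex.I * z 0 - z 5, 0, z 1 - Complex.I * z 2, -z 3 + Complex.I * z 4;
    -z 3 - Complex.I * z 4, -z 1 + Complex.I * z 2, 0, -Complex.I * z 0 + z 5;
    -z 1 - Complex.I * z 2, z 3 - Complex.I * z 4, Complex.I * z 0 - z 5, 0]

/-- The partial derivative `∂g/∂x^j` at `x` of a complex-valued function on `ℝ⁶`. -/
def pd (j : Fin 6) (g : E6 → ℂ) (x : E6) : ℂ := fderiv ℝ g x (EuclideanSpace.single j (1 : ℝ))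

/-- The complex vector field `∇^{AB}`: the entry `(A, B)` of the matrix `ι(x)` with each coordinate
`x^j` replaced by `∂_{x^j}`. -/
def nabla (a b : Fin 4) (g : E6 → ℂ) (x : E6) : ℂ := iota (fun j => pd j g x) a b

/-- The operator `𝒟_q`:
`(𝒟_q f)^{A₁…A_{q+1}}_{B₂…B_{p+1}} = ∑_{B₁} ∇^{B₁[A₁} f^{A₂…A_{q+1}]}_{B₁B₂…B_{p+1}}`, where `[…]`
denotes antisymmetrization, the average over all permutations weighted with their signs. -/
def diffOp (p q : ℕ) (f : E6 → Tensor (p + 1) q) : E6 → Tensor p (q + 1) := fun x A B =>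
  (Nat.factorial (q + 1) : ℂ)⁻¹ * ∑ σ : Equiv.Perm (Fin (q + 1)), ((Equiv.Perm.sign σ : ℤ) : ℂ) *
    ∑ b : Fin 4,
      nabla b (A (σ 0)) (fun y => f y (fun i => A (σ i.succ)) (Fin.cons b B)) x

/-- A complex-valued function on `ℝ⁶` that is a polynomial in the coordinates, with complex
coefficients. -/
def IsPoly (g : E6 → ℂ) : Prop :=
  ∃ φ : MvPolynomial (Fin 6) ℂ, ∀ x : E6, g x = MvPolynomial.eval (fun i => ((x i : ℝ) : ℂ)) φ

theorem IsPoly.zero : IsPoly (fun _ => 0) := ⟨0, by simp⟩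

theorem IsPoly.add {g h : E6 → ℂ} (hg : IsPoly g) (hh : IsPoly h) :
    IsPoly (fun x => g x + h x) := by
  obtain ⟨φ, hφ⟩ := hg
  obtain ⟨ψ, hψ⟩ := hh
  exact ⟨φ + ψ, fun x => by simp [hφ, hψ]⟩

theorem IsPoly.const_mul (c : ℂ) {g : E6 → ℂ} (hg : IsPoly g) :
    IsPoly (fun x => c * g x) := by
  obtain ⟨φ, hφ⟩ := hg
  exact ⟨MvPolynomial.C c * φ, fun x => by simp [hφ]⟩

theorem IsPoly.sum {ι : Type*} (s : Finset ι) {g : ι → E6 → ℂ} (hg : ∀ i ∈ s, IsPoly (g i)) :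
    IsPoly (fun x => ∑ i ∈ s, g i x) := by
  classical
  induction s using Finset.induction_on with
  | empty => simpa using IsPoly.zero
  | insert a s ha ih =>
    simp only [Finset.sum_insert ha]
    exact (hg a (by simp)).add (ih fun i hi => hg i (by simp [hi]))

/-- Evaluation of a polynomial on `ℝ⁶` has the formal partial derivatives as its partial
derivatives. -/
theorem hasFDerivAt_eval (φ : MvPolynomial (Fin 6) ℂ) (x : E6) :
    ∃ L : E6 →L[ℝ] ℂ,
      HasFDerivAt (fun y : E6 => MvPolynomial.eval (fun i => ((y i : ℝ) : ℂ)) φ) L x ∧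
      ∀ j, L (EuclideanSpace.single j (1 : ℝ)) =
        MvPolynomial.eval (fun i => ((x i : ℝ) : ℂ)) (MvPolynomial.pderiv j φ) := by
  induction φ using MvPolynomial.induction_on with
  | C a => exact ⟨0, by simpa using hasFDerivAt_const a x, by simp⟩
  | add p q hp hq =>
    obtain ⟨L, hL, hL'⟩ := hp
    obtain ⟨M, hM, hM'⟩ := hq
    refine ⟨L + M, ?_, fun j => by simp [hL', hM']⟩
    simpa using hL.fun_add hM
  | mul_X p i hp =>
    obtain ⟨L, hL, hL'⟩ := hp
    have hX : HasFDerivAt (fun y : E6 => ((y i : ℝ) : ℂ))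
        (Complex.ofRealCLM.comp (EuclideanSpace.proj i : E6 →L[ℝ] ℝ)) x :=
      (Complex.ofRealCLM.comp (EuclideanSpace.proj i : E6 →L[ℝ] ℝ)).hasFDerivAt
    refine ⟨_, by simpa using hL.fun_mul hX, fun j => ?_⟩
    by_cases hij : i = j
    · subst hij
      simp [hL']
    · simp [hL', MvPolynomial.pderiv_X_of_ne hij, hij]

theorem IsPoly.differentiable {g : E6 → ℂ} (hg : IsPoly g) : Differentiable ℝ g := by
  obtain ⟨φ, hφ⟩ := hg
  obtain rfl : g = _ := funext hφ
  intro x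
  obtain ⟨L, hL, -⟩ := hasFDerivAt_eval φ x
  exact hL.differentiableAt

theorem pd_eval (j : Fin 6) (φ : MvPolynomial (Fin 6) ℂ) (x : E6) :
    pd j (fun y : E6 => MvPolynomial.eval (fun i => ((y i : ℝ) : ℂ)) φ) x =
      MvPolynomial.eval (fun i => ((x i : ℝ) : ℂ)) (MvPolynomial.pderiv j φ) := by
  obtain ⟨L, hL, hL'⟩ := hasFDerivAt_eval φ x
  rw [pd, hL.fderiv, hL']

theorem IsPoly.pd {g : E6 → ℂ} (hg : IsPoly g) (j : Fin 6) : IsPoly (pd j g) := by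
  obtain ⟨φ, hφ⟩ := hg
  obtain rfl : g = _ := funext hφ
  exact ⟨MvPolynomial.pderiv j φ, pd_eval j φ⟩

theorem iota_apply (z : Fin 6 → ℂ) (a b : Fin 4) :
    iota z a b = ∑ j, iota (Pi.single j 1) a b * z j := by
  fin_cases a <;> fin_cases b <;> simp [iota, Fin.sum_univ_succ, Pi.single_apply] <;> ring

theorem iota_symm_neg (z : Fin 6 → ℂ) (a b : Fin 4) : iota z a b = -iota z b a := by
  fin_cases a <;> fin_cases b <;> simp [iota] <;> ring

theorem nabla_eq_sum (a b : Fin 4) (g : E6 → ℂ) (x : E6) :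
    nabla a b g x = ∑ j, iota (Pi.single j 1) a b * KMonogenic.pd j g x := iota_apply _ a b

theorem nabla_neg (a b : Fin 4) (g : E6 → ℂ) (x : E6) : nabla a b g x = -nabla b a g x :=
  iota_symm_neg _ a b

theorem IsPoly.nabla {g : E6 → ℂ} (hg : IsPoly g) (a b : Fin 4) :
    IsPoly (nabla a b g) := by
  have : KMonogenic.nabla a b g = fun x => ∑ j, iota (Pi.single j 1) a b * KMonogenic.pd j g x :=
    funext fun x => nabla_eq_sum a b g x
  rw [this]
  exact IsPoly.sum _ fun j _ => (hg.pd j).const_mul _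

theorem nabla_add (a b : Fin 4) {g h : E6 → ℂ} (hg : IsPoly g) (hh : IsPoly h) (x : E6) :
    nabla a b (fun y => g y + h y) x = nabla a b g x + nabla a b h x := by
  simp only [nabla_eq_sum, ← Finset.sum_add_distrib, ← mul_add]
  refine Finset.sum_congr rfl fun j _ => ?_
  congr 1
  have : fderiv ℝ (fun y => g y + h y) x = fderiv ℝ g x + fderiv ℝ h x :=
    fderiv_fun_add (hg.differentiable x) (hh.differentiable x)
  simp [pd, this]

theorem nabla_const_mul (a b : Fin 4) (c : ℂ) {g : E6 → ℂ} (hg : IsPoly g) (x : E6) :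
    nabla a b (fun y => c * g y) x = c * nabla a b g x := by
  simp only [nabla_eq_sum, Finset.mul_sum]
  refine Finset.sum_congr rfl fun j _ => ?_
  have : fderiv ℝ (fun y => c * g y) x = c • fderiv ℝ g x :=
    fderiv_const_mul (hg.differentiable x) c
  simp [pd, this]
  ring

theorem nabla_zero (a b : Fin 4) (x : E6) : nabla a b (fun _ => 0) x = 0 := by
  simp [nabla_eq_sum, pd]

theorem nabla_sum {ι : Type*} (s : Finset ι) (a b : Fin 4) {g : ι → E6 → ℂ}
    (hg : ∀ i ∈ s, IsPoly (g i)) (x : E6) :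
    nabla a b (fun y => ∑ i ∈ s, g i y) x = ∑ i ∈ s, nabla a b (g i) x := by
  classical
  induction s using Finset.induction_on with
  | empty => simpa using nabla_zero a b x
  | insert i s hi ih =>
    simp only [Finset.sum_insert hi]
    rw [nabla_add a b (hg i (by simp)) (IsPoly.sum s fun i h => hg i (by simp [h])),
      ih fun i h => hg i (by simp [h])]

/-- `P(ℝ⁶, 𝒱)`: the `𝒱`-valued polynomials over `ℝ⁶`, that is, the functions on `ℝ⁶` with values
in `𝒱 ⊆ ⊙^p ℂ⁴ ⊗ ∧^q ℂ⁴` whose components are polynomials. -/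
def polyV (p q : ℕ) : Submodule ℂ (E6 → Tensor p q) where
  carrier := {f | (∀ x, f x ∈ calV p q) ∧ ∀ A B, IsPoly (fun x => f x A B)}
  add_mem' := by
    rintro f g ⟨hf, hf'⟩ ⟨hg, hg'⟩
    exact ⟨fun x => (calV p q).add_mem (hf x) (hg x), fun A B => (hf' A B).add (hg' A B)⟩
  zero_mem' := ⟨fun _ => (calV p q).zero_mem, fun _ _ => IsPoly.zero⟩
  smul_mem' := by
    rintro c f ⟨hf, hf'⟩
    exact ⟨fun x => (calV p q).smul_mem c (hf x), fun A B => (hf' A B).const_mul c⟩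

theorem calV_le_symAlt (p q : ℕ) : calV p q ≤ symAlt p q := by
  rcases p with _ | p <;> rcases q with _ | q
  · exact le_rfl
  · exact le_rfl
  · exact le_rfl
  · exact inf_le_left

/-- Every simultaneous trace over one upper and one lower index vanishes on `𝒱`. -/
theorem calV_trace {p q : ℕ} {f : Tensor (p + 1) (q + 1)} (hf : f ∈ calV (p + 1) (q + 1))
    (j : Fin (q + 1)) (A : Fin q → Fin 4) (B : Fin p → Fin 4) :
    ∑ C, f (j.insertNth C A) (Fin.snoc B C) = 0 := by
  obtain ⟨⟨-, hs⟩, hc⟩ := hf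
  have h0 : ∑ C, f (Fin.cons C A) (Fin.snoc B C) = 0 :=
    congrFun (congrFun (LinearMap.mem_ker.1 hc) A) B
  have key : ∀ C, f (j.insertNth C A) (Fin.snoc B C) =
      ((Equiv.Perm.sign j.cycleRange : ℤ) : ℂ) * f (Fin.cons C A) (Fin.snoc B C) := by
    intro C
    rw [← hs]
    congr 1
    funext i
    refine Fin.succAboveCases j ?_ (fun i => ?_) i
    · simp
    · simp
  simp only [key, ← Finset.mul_sum, h0, mul_zero]

theorem diffOp_mem_symAlt {p q : ℕ} {f : E6 → Tensor (p + 1) q}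
    (hf : ∀ x, f x ∈ symAlt (p + 1) q) (x : E6) : diffOp p q f x ∈ symAlt p (q + 1) := by
  refine ⟨fun A B τ => ?_, fun A B ρ => ?_⟩
  · have key : ∀ (A' : Fin q → Fin 4) (b : Fin 4) (y : E6),
        f y A' (Fin.cons b fun i => B (τ i)) = f y A' (Fin.cons b B) := by
      intro A' b y
      rw [← (hf y).1 A' (Fin.cons b B) (Equiv.Perm.decomposeFin.symm (0, τ))]
      congr 1
      funext i
      refine Fin.cases ?_ (fun i => ?_) i
      · simp
      · simp
    simp only [diffOp, key]
  · simp only [diffOp]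
    rw [mul_left_comm]
    congr 1
    rw [Finset.mul_sum]
    refine Fintype.sum_equiv (Equiv.mulLeft ρ) _ _ fun σ => ?_
    simp only [Equiv.coe_mulLeft, Equiv.Perm.coe_mul, Function.comp_apply, Equiv.Perm.sign_mul,
      Units.val_mul, Int.cast_mul]
    rw [← mul_assoc, ← mul_assoc]
    congr 2
    rcases Int.units_eq_one_or (Equiv.Perm.sign ρ) with h | h <;> simp [h]

theorem diffOp_mem_calV {p q : ℕ} {f : E6 → Tensor (p + 1) q} (hf : f ∈ polyV (p + 1) q)
    (x : E6) : diffOp p q f x ∈ calV p (q + 1) := by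
  have hs : ∀ x, f x ∈ symAlt (p + 1) q := fun x => calV_le_symAlt _ _ (hf.1 x)
  have hsym := diffOp_mem_symAlt hs x
  rcases p with _ | p
  · exact hsym
  refine ⟨hsym, ?_⟩
  rw [SetLike.mem_coe, LinearMap.mem_ker]
  funext A B
  change ∑ C, diffOp (p + 1) q f x (Fin.cons C A) (Fin.snoc B C) = 0
  simp only [diffOp]
  rw [← Finset.mul_sum, Finset.sum_comm]
  refine mul_eq_zero_of_right _ (Finset.sum_eq_zero fun σ _ => ?_)
  rw [← Finset.mul_sum]
  refine mul_eq_zero_of_right _ ?_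
  have hcons : ∀ b C : Fin 4,
      (Fin.cons b (Fin.snoc B C : Fin (p + 1) → Fin 4) : Fin (p + 1 + 1) → Fin 4) =
        Fin.snoc (Fin.cons b B : Fin (p + 1) → Fin 4) C := fun b C => Fin.cons_snoc_eq_snoc_cons b B C
  by_cases h0 : σ 0 = 0
  · have hA : ∀ C, (fun i : Fin q => (Fin.cons C A : Fin (q + 1) → Fin 4) (σ i.succ)) =
        fun i : Fin q => (Fin.cons 0 A : Fin (q + 1) → Fin 4) (σ i.succ) := by
      intro C
      funext i
      have hi : σ i.succ ≠ 0 := fun h => Fin.succ_ne_zero i (σ.injective (h.trans h0.symm))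
      obtain ⟨m, hm⟩ := Fin.exists_succ_eq.2 hi
      simp [← hm]
    simp only [h0, hA, Fin.cons_zero]
    set A' := fun i : Fin q => (Fin.cons 0 A : Fin (q + 1) → Fin 4) (σ i.succ)
    have hsw : ∀ (b C : Fin 4) (y : E6),
        f y A' (Fin.cons b (Fin.snoc B C : Fin (p + 1) → Fin 4)) =
          f y A' (Fin.cons C (Fin.snoc B b : Fin (p + 1) → Fin 4)) := by
      intro b C y
      rw [← (hs y).1 A' (Fin.cons C (Fin.snoc B b : Fin (p + 1) → Fin 4))
        (Equiv.swap 0 (Fin.last (p + 1)))]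
      congr 1
      funext i
      refine Fin.cases ?_ (fun i => ?_) i
      · rw [Equiv.swap_apply_left, hcons C b]
        simp
      · refine Fin.lastCases ?_ (fun i => ?_) i
        · simp
        · rw [Equiv.swap_apply_of_ne_of_ne (Fin.succ_ne_zero _)]
          · simp
          · simp [Fin.ext_iff]
            omega
    have hneg : ∀ b C : Fin 4,
        nabla b C (fun y => f y A' (Fin.cons b (Fin.snoc B C : Fin (p + 1) → Fin 4))) x =
        -nabla C b (fun y => f y A' (Fin.cons C (Fin.snoc B b : Fin (p + 1) → Fin 4))) x := by
      intro b C
      rw [nabla_neg]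
      simp only [hsw b C]
    set F : Fin 4 → Fin 4 → ℂ := fun C b =>
      nabla b C (fun y => f y A' (Fin.cons b (Fin.snoc B C : Fin (p + 1) → Fin 4))) x with hF
    have h1 : ∑ C, ∑ b, F C b = -∑ C, ∑ b, F C b := by
      conv_lhs => rw [Finset.sum_comm]
      simp only [← Finset.sum_neg_distrib]
      exact Finset.sum_congr rfl fun b _ => Finset.sum_congr rfl fun C _ => hneg b C
    exact self_eq_neg.1 h1
  · rw [Finset.sum_comm]
    refine Finset.sum_eq_zero fun b _ => ?_
    rcases q with _ | q
    · exact absurd (Fin.eq_zero (σ (0 : Fin 1))) h0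
    obtain ⟨a, ha⟩ := Fin.exists_succ_eq.2 h0
    obtain ⟨j, hj⟩ : ∃ j : Fin (q + 1), j.succ = σ.symm 0 := by
      refine Fin.exists_succ_eq.2 fun h => h0 ?_
      exact ((Equiv.symm_apply_eq σ).1 h).symm
    have hj' : σ j.succ = 0 := by rw [hj, Equiv.apply_symm_apply]
    set A' : Fin q → Fin 4 := fun i => (Fin.cons 0 A : Fin (q + 1 + 1) → Fin 4)
      (σ (j.succAbove i).succ) with hA'
    have hA : ∀ C, (fun i : Fin (q + 1) => (Fin.cons C A : Fin (q + 1 + 1) → Fin 4) (σ i.succ)) =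
        j.insertNth C A' := by
      intro C
      funext i
      refine Fin.succAboveCases j ?_ (fun i => ?_) i
      · simp [hj']
      · have hi : σ (j.succAbove i).succ ≠ 0 := fun h =>
          Fin.succAbove_ne j i (Fin.succ_injective _ (σ.injective (h.trans hj'.symm)))
        obtain ⟨m, hm⟩ := Fin.exists_succ_eq.2 hi
        simp [hA', ← hm]
    have hterm : ∀ C : Fin 4,
        nabla b ((Fin.cons C A : Fin (q + 1 + 1) → Fin 4) (σ 0)) (fun y => f y
          (fun i : Fin (q + 1) => (Fin.cons C A : Fin (q + 1 + 1) → Fin 4) (σ i.succ))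
          (Fin.cons b (Fin.snoc B C : Fin (p + 1) → Fin 4))) x =
        nabla b (A a) (fun y => f y (j.insertNth C A')
          (Fin.snoc (Fin.cons b B : Fin (p + 1) → Fin 4) C)) x := by
      intro C
      rw [hA C, hcons b C, ← ha, Fin.cons_succ]
    rw [Finset.sum_congr rfl fun C _ => hterm C, ← nabla_sum _ _ _ fun C _ => hf.2 _ _]
    have : (fun y => ∑ C, f y (j.insertNth C A')
        (Fin.snoc (Fin.cons b B : Fin (p + 1) → Fin 4) C)) = fun _ => 0 :=
      funext fun y => calV_trace (hf.1 y) j A' _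
    rw [this, nabla_zero]

theorem diffOp_isPoly {p q : ℕ} {f : E6 → Tensor (p + 1) q} (hf : ∀ A B, IsPoly fun x => f x A B)
    (A : Fin (q + 1) → Fin 4) (B : Fin p → Fin 4) : IsPoly (fun x => diffOp p q f x A B) :=
  (IsPoly.sum _ fun _ _ => (IsPoly.sum _ fun _ _ => (hf _ _).nabla _ _).const_mul _).const_mul _

/-- The restriction of `𝒟_q` to `𝒱`-valued polynomials, as a linear map
`P(ℝ⁶, 𝒱_q) → P(ℝ⁶, 𝒱_{q+1})` (with `k = p + 1 + q`). -/
def polyD (p q : ℕ) : polyV (p + 1) q →ₗ[ℂ] polyV p (q + 1) where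
  toFun f := ⟨diffOp p q f.1, fun x => diffOp_mem_calV f.2 x, diffOp_isPoly f.2.2⟩
  map_add' f g := by
    refine Subtype.ext (funext fun x => funext fun A => funext fun B => ?_)
    simp only [diffOp, Submodule.coe_add, Pi.add_apply]
    rw [← mul_add, ← Finset.sum_add_distrib]
    congr 1
    refine Finset.sum_congr rfl fun σ _ => ?_
    rw [← mul_add, ← Finset.sum_add_distrib]
    congr 1
    exact Finset.sum_congr rfl fun b _ => nabla_add _ _ (f.2.2 _ _) (g.2.2 _ _) x
  map_smul' c f := by
    refine Subtype.ext (funext fun x => funext fun A => funext fun B => ?_)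
    simp only [diffOp, Submodule.coe_smul, Pi.smul_apply, smul_eq_mul, RingHom.id_apply]
    rw [mul_left_comm]
    congr 1
    rw [Finset.mul_sum]
    refine Finset.sum_congr rfl fun σ _ => ?_
    rw [mul_left_comm]
    congr 1
    rw [Finset.mul_sum]
    exact Finset.sum_congr rfl fun b _ => nabla_const_mul _ _ c (f.2.2 _ _) x

end KMonogenic

end

/-! A symmetric tensor with polynomial entries is a polynomial-valued function on multisets of lower
indices; families of all degrees together form the module `Sec`. On it act commuting operators T_i
(fix one lower index) and X_j (differentiate), in complex linear coordinates chosen so that each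
entry of ∇ is 0 or some ±X_j. Put P_A = ∑_B ∇^{BA} T_B. A section of 𝒱_q, q ≥ 1, with lower indices
left is an alternating q-form c over `Sec` in four symbols e₀, …, e₃ with ι_T c = 0, and 𝒟_q is P∧
up to a factor. As ∇ is antisymmetric, ∑ P_A T_A = 0, so ι_T and P∧ anticommute.

Exactness is then a chase through Koszul complexes. It has three inputs: T₀, T₁, T₂ is coregular
(`coregular_opT`), P₀, P₁, P₂ is coregular (`coregular_opP`), and T-closed one-forms are T-gradients
(`exists_potential`). Hodge duality in dimension four turns P∧ into contraction with P, so that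
contraction lemmas serve both operators. Up to sign, with vol = e₀₁₂₃: at 𝒱₃, t = ι_T(G vol) with G
= P₀η, hence t = P∧ι_T(η e₁₂₃); at 𝒱₂, w = ι_T v, and P∧w = 0 makes every T_i kill the coefficient
of P∧v, which is therefore confined to degree 0 and removed by truncating v; then v = P∧b and w =
P∧ι_T b; at 𝒱₁, u = ι_T b and P∧b = ι_T(G vol) with G = P₀η, so b + ι_T(η e₁₂₃) is P-closed, hence
of the form P∧a, and u = (ι_T a)P.

The coregularity of P is an initial-term argument. For suitable weights the leading terms of P₀, P₁,
P₂ are, up to sign, X₂T₃, X₃T₂, X₁T₀. They share neither variable nor index, so each has a right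
inverse commuting with the other leading terms, and an approximate solution is improved until the
remainder has weight below zero. -/

noncomputable section

namespace KMonogenic

/-! ### Koszul algebra over a commutative ring -/

section Koszul

variable {R H : Type*} [CommRing R] [AddCommGroup H] [Module R H]

/-- `Q₀, Q₁` is a coregular sequence on `H`: each element is surjective on the common kernel of
the preceding ones. -/
def Coregular₂ (H : Type*) [AddCommGroup H] [Module R H] (Q : Fin 4 → R) : Prop :=
  (∀ v : H, ∃ u : H, Q 0 • u = v) ∧
  (∀ v : H, Q 0 • v = 0 → ∃ u : H, Q 0 • u = 0 ∧ Q 1 • u = v)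

/-- `Q₀, Q₁, Q₂` is a coregular sequence on `H`. -/
def Coregular₃ (H : Type*) [AddCommGroup H] [Module R H] (Q : Fin 4 → R) : Prop :=
  Coregular₂ H Q ∧
  (∀ v : H, Q 0 • v = 0 → Q 1 • v = 0 → ∃ u : H, Q 0 • u = 0 ∧ Q 1 • u = 0 ∧ Q 2 • u = v)

/-- Exactness of the Koszul complex at the place next to its end. -/
theorem koszul_exact_one {Q : Fin 4 → R} (hQ : Coregular₂ H Q) {u₀ u₁ u₂ u₃ : H}
    (h : Q 0 • u₀ + Q 1 • u₁ + Q 2 • u₂ + Q 3 • u₃ = 0) :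
    ∃ b₁ b₂ b₃ : H, u₁ = Q 0 • b₁ ∧ u₂ = Q 0 • b₂ ∧ u₃ = Q 0 • b₃ ∧
      u₀ = -(Q 1 • b₁ + Q 2 • b₂ + Q 3 • b₃) := by
  obtain ⟨h0, h1⟩ := hQ
  obtain ⟨a₁, rfl⟩ := h0 u₁
  obtain ⟨a₂, rfl⟩ := h0 u₂
  obtain ⟨a₃, rfl⟩ := h0 u₃
  -- After lifting u₁, u₂, u₃ through Q₀, the relation says that Q₀ kills the defect of u₀.
  -- Subtracting z from a₁ removes the defect without changing u₁.
  obtain ⟨z, hz, hz'⟩ := h1 (u₀ + Q 1 • a₁ + Q 2 • a₂ + Q 3 • a₃)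
    (by linear_combination (norm := module) h)
  refine ⟨a₁ - z, a₂, a₃, ?_, rfl, rfl, ?_⟩
  · linear_combination (norm := module) hz
  · linear_combination (norm := module) -hz'

/-- Exactness of the Koszul complex at bivectors: each `w` that is annihilated by the contraction
with `Q` is the contraction of a trivector. -/
theorem koszul_exact_two {Q : Fin 4 → R} (hQ : Coregular₃ H Q) {w₀₁ w₀₂ w₀₃ w₁₂ w₁₃ w₂₃ : H}
    (e₀ : Q 1 • w₀₁ + Q 2 • w₀₂ + Q 3 • w₀₃ = 0)
    (e₁ : Q 0 • w₀₁ - Q 2 • w₁₂ - Q 3 • w₁₃ = 0)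
    (e₂ : Q 0 • w₀₂ + Q 1 • w₁₂ - Q 3 • w₂₃ = 0)
    (e₃ : Q 0 • w₀₃ + Q 1 • w₁₃ + Q 2 • w₂₃ = 0) :
    ∃ v₁₂ v₁₃ v₂₃ : H, w₁₂ = Q 0 • v₁₂ ∧ w₁₃ = Q 0 • v₁₃ ∧ w₂₃ = Q 0 • v₂₃ ∧
      w₀₁ = Q 2 • v₁₂ + Q 3 • v₁₃ ∧ w₀₂ = -(Q 1 • v₁₂) + Q 3 • v₂₃ ∧
      w₀₃ = -(Q 1 • v₁₃) - Q 2 • v₂₃ := by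
  obtain ⟨⟨h0, h1⟩, h2⟩ := hQ
  obtain ⟨a₁₂, rfl⟩ := h0 w₁₂
  obtain ⟨a₁₃, rfl⟩ := h0 w₁₃
  obtain ⟨a₂₃, rfl⟩ := h0 w₂₃
  obtain ⟨c₂, hc₂, hc₂'⟩ := h1 (w₀₂ + Q 1 • a₁₂ - Q 3 • a₂₃) (by linear_combination (norm := module) e₂)
  obtain ⟨c₃, hc₃, hc₃'⟩ := h1 (w₀₃ + Q 1 • a₁₃ + Q 2 • a₂₃) (by linear_combination (norm := module) e₃)
  -- c₂ and c₃ repair w₀₂ and w₀₃; what is left of w₀₁ is killed by Q₀ and Q₁, which is where the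
  -- third coregularity condition enters.
  obtain ⟨z, hz, hz', hz''⟩ := h2 (w₀₁ - Q 2 • a₁₂ - Q 3 • a₁₃ + Q 2 • c₂ + Q 3 • c₃)
    (by linear_combination (norm := module) e₁ + Q 2 • hc₂ + Q 3 • hc₃)
    (by linear_combination (norm := module) e₀ + Q 2 • hc₂' + Q 3 • hc₃')
  refine ⟨a₁₂ - c₂ + z, a₁₃ - c₃, a₂₃, ?_, ?_, rfl, ?_, ?_, ?_⟩
  · linear_combination (norm := module) hc₂ - hz
  · linear_combination (norm := module) hc₃
  · linear_combination (norm := module) -hz''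
  · linear_combination (norm := module) -hc₂' + hz'
  · linear_combination (norm := module) -hc₃'

variable {T P : Fin 4 → R}

/-- Exactness at `𝒱₁`. -/
theorem exact_at_one (hTP : P 0 * T 0 + P 1 * T 1 + P 2 * T 2 + P 3 * T 3 = 0)
    (hT : Coregular₂ H T) (hP : Coregular₃ H P)
    (hgrad : ∀ g : Fin 4 → H, (∀ i j, T i • g j = T j • g i) → ∃ G : H, ∀ i, T i • G = g i)
    (u : Fin 4 → H) (hC : ∑ i, T i • u i = 0) (hD : ∀ i j, P i • u j - P j • u i = 0) :
    ∃ φ : H, ∀ i, u i = P i • φ := by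
  rw [Fin.sum_univ_four] at hC
  obtain ⟨b₁, b₂, b₃, h₁, h₂, h₃, h₀⟩ := koszul_exact_one hT hC
  have hTP' : ∀ y : H, (P 0 * T 0 + P 1 * T 1 + P 2 * T 2 + P 3 * T 3) • y = 0 := by simp [hTP]
  have d01 := hD 0 1
  have d02 := hD 0 2
  have d03 := hD 0 3
  have d12 := hD 1 2
  have d13 := hD 1 3
  have d23 := hD 2 3
  rw [h₀, h₁] at d01
  rw [h₀, h₂] at d02
  rw [h₀, h₃] at d03
  rw [h₁, h₂] at d12
  rw [h₁, h₃] at d13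
  rw [h₂, h₃] at d23
  -- With b read as the bivector e₀∧b, P∧ι_T b = 0 becomes ι_T(P∧b) = 0. Dually, the vector (0, P×b)
  -- is T-closed.
  have c01 : T 0 • (P 2 • b₃ - P 3 • b₂) = 0 := by linear_combination (norm := module) d23
  have c02 : T 0 • (P 3 • b₁ - P 1 • b₃) = 0 := by linear_combination (norm := module) -d13
  have c03 : T 0 • (P 1 • b₂ - P 2 • b₁) = 0 := by linear_combination (norm := module) d12
  have c12 : T 1 • (P 3 • b₁ - P 1 • b₃) = T 2 • (P 2 • b₃ - P 3 • b₂) := by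
    linear_combination (norm := module) d03 - hTP' b₃
  have c13 : T 1 • (P 1 • b₂ - P 2 • b₁) = T 3 • (P 2 • b₃ - P 3 • b₂) := by
    linear_combination (norm := module) -d02 + hTP' b₂
  have c23 : T 2 • (P 1 • b₂ - P 2 • b₁) = T 3 • (P 3 • b₁ - P 1 • b₃) := by
    linear_combination (norm := module) d01 - hTP' b₁
  obtain ⟨G, hG⟩ := hgrad ![0, P 2 • b₃ - P 3 • b₂, P 3 • b₁ - P 1 • b₃, P 1 • b₂ - P 2 • b₁] (by
    intro i j
    fin_cases i <;> fin_cases j <;> simp only [Fin.mk_one, Fin.zero_eta, Fin.reduceFinMk,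
      Matrix.cons_val, smul_zero, c01, c02, c03, c12, c13, c23])
  have g0 : T 0 • G = 0 := hG 0
  have g1 : T 1 • G = P 2 • b₃ - P 3 • b₂ := hG 1
  have g2 : T 2 • G = P 3 • b₁ - P 1 • b₃ := hG 2
  have g3 : T 3 • G = P 1 • b₂ - P 2 • b₁ := hG 3
  obtain ⟨η, rfl⟩ := hP.1.1 G
  -- The bivector entered here is the Hodge dual of e₀∧b + ι_T(η e₁₂₃), which P∧ annihilates.
  obtain ⟨v₁₂, v₁₃, v₂₃, k₁₂, k₁₃, k₂₃, k₀₁, k₀₂, k₀₃⟩ := koszul_exact_two hP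
    (w₀₁ := T 1 • η) (w₀₂ := T 2 • η) (w₀₃ := T 3 • η) (w₁₂ := b₃) (w₁₃ := -b₂) (w₂₃ := b₁)
    (by linear_combination (norm := module) hTP' η - g0)
    (by linear_combination (norm := module) g1)
    (by linear_combination (norm := module) g2)
    (by linear_combination (norm := module) g3)
  have k₁₃' : b₂ = -(P 0 • v₁₃) := by rw [← k₁₃, neg_neg]
  refine ⟨-(T 1 • v₂₃ - T 2 • v₁₃ + T 3 • v₁₂), fun i => ?_⟩
  fin_cases i
  · change u 0 = P 0 • _
    rw [h₀, k₂₃, k₁₃', k₁₂]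
    module
  · change u 1 = P 1 • _
    rw [h₁, k₂₃]
    linear_combination (norm := module) hTP' v₂₃ - T 2 • k₀₃ + T 3 • k₀₂
  · change u 2 = P 2 • _
    rw [h₂, k₁₃']
    linear_combination (norm := module) -hTP' v₁₃ + T 1 • k₀₃ - T 3 • k₀₁
  · change u 3 = P 3 • _
    rw [h₃, k₁₂]
    linear_combination (norm := module) hTP' v₁₂ - T 1 • k₀₂ + T 2 • k₀₁

/-- The components of the contraction of a trivector `v` with `v₁₂₃ = 0`. -/
def IsContr (T : Fin 4 → R) (w : Fin 4 → Fin 4 → H) (v₁₂ v₁₃ v₂₃ : H) : Prop :=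
  w 1 2 = T 0 • v₁₂ ∧ w 1 3 = T 0 • v₁₃ ∧ w 2 3 = T 0 • v₂₃ ∧
    w 0 1 = T 2 • v₁₂ + T 3 • v₁₃ ∧ w 0 2 = -(T 1 • v₁₂) + T 3 • v₂₃ ∧
    w 0 3 = -(T 1 • v₁₃) - T 2 • v₂₃

/-- Koszul exactness for T: the trivector it supplies has no e₁₂₃ component, leaving three unknowns.
-/
theorem exists_isContr (hT : Coregular₃ H T) (w : Fin 4 → Fin 4 → H)
    (hw0 : ∀ i, w i i = 0) (hw : ∀ i j, w i j = -w j i) (hC : ∀ j, ∑ i, T i • w i j = 0) :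
    ∃ v₁₂ v₁₃ v₂₃ : H, IsContr T w v₁₂ v₁₃ v₂₃ := by
  have e0 := hC 0
  have e1 := hC 1
  have e2 := hC 2
  have e3 := hC 3
  simp only [Fin.sum_univ_four, hw0, hw 1 0, hw 2 0, hw 3 0, hw 2 1, hw 3 1, hw 3 2]
    at e0 e1 e2 e3
  exact koszul_exact_two hT (by linear_combination (norm := module) -e0)
    (by linear_combination (norm := module) e1)
    (by linear_combination (norm := module) e2) (by linear_combination (norm := module) e3)

/-- P∧ι_T v = -ι_T(P∧v), and P∧v has a single coefficient, so each T_i kills it. This does not force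
the coefficient to vanish: its degree 0 part is invisible to all T_i. -/
theorem IsContr.smul_eq_zero (hTP : P 0 * T 0 + P 1 * T 1 + P 2 * T 2 + P 3 * T 3 = 0)
    {w : Fin 4 → Fin 4 → H} {v₁₂ v₁₃ v₂₃ : H} (hw : ∀ i j, w i j = -w j i)
    (h : IsContr T w v₁₂ v₁₃ v₂₃)
    (hD : ∀ i j k, P i • w j k + P j • w k i + P k • w i j = 0) (i : Fin 4) :
    T i • (-(P 1 • v₂₃) + P 2 • v₁₃ - P 3 • v₁₂) = 0 := by
  obtain ⟨h12, h13, h23, h01, h02, h03⟩ := h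
  have hTP' : ∀ y : H, (P 0 * T 0 + P 1 * T 1 + P 2 * T 2 + P 3 * T 3) • y = 0 := by simp [hTP]
  have d123 := hD 1 2 3
  have d023 := hD 0 2 3
  have d013 := hD 0 1 3
  have d012 := hD 0 1 2
  rw [hw 3 1, h12, h13, h23] at d123
  rw [hw 3 0, h23, h02, h03] at d023
  rw [hw 3 0, h13, h01, h03] at d013
  rw [hw 2 0, h12, h01, h02] at d012
  fin_cases i
  · change T 0 • _ = _
    linear_combination (norm := module) -d123
  · change T 1 • _ = _
    linear_combination (norm := module) d023 - hTP' v₂₃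
  · change T 2 • _ = _
    linear_combination (norm := module) -d013 + hTP' v₁₃
  · change T 3 • _ = _
    linear_combination (norm := module) d012 - hTP' v₁₂

/-- Exactness at `𝒱₂`. -/
theorem exact_at_two (hTP : P 0 * T 0 + P 1 * T 1 + P 2 * T 2 + P 3 * T 3 = 0)
    (hP : Coregular₂ H P) {w : Fin 4 → Fin 4 → H} {v₁₂ v₁₃ v₂₃ : H}
    (hw0 : ∀ i, w i i = 0) (hw : ∀ i j, w i j = -w j i) (h : IsContr T w v₁₂ v₁₃ v₂₃)
    (hz : -(P 1 • v₂₃) + P 2 • v₁₃ - P 3 • v₁₂ = 0) :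
    ∃ u : Fin 4 → H, ∑ i, T i • u i = 0 ∧ ∀ i j, w i j = P i • u j - P j • u i := by
  obtain ⟨h12, h13, h23, h01, h02, h03⟩ := h
  have hTP' : ∀ y : H, (P 0 * T 0 + P 1 * T 1 + P 2 * T 2 + P 3 * T 3) • y = 0 := by simp [hTP]
  -- The vector (0, -v₂₃, v₁₃, -v₁₂) is the dual of v up to sign, and P∧v = 0 says that its
  -- contraction with P vanishes.
  obtain ⟨b₁, b₂, b₃, k₁, k₂, k₃, k₀⟩ := koszul_exact_one hP (u₀ := 0) (u₁ := -v₂₃) (u₂ := v₁₃)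
    (u₃ := -v₁₂) (by linear_combination (norm := module) hz)
  have k₁' : v₂₃ = -(P 0 • b₁) := by rw [← k₁, neg_neg]
  have k₃' : v₁₂ = -(P 0 • b₃) := by rw [← k₃, neg_neg]
  rw [k₃'] at h12
  rw [k₂] at h13
  rw [k₁'] at h23
  rw [k₃', k₂] at h01
  rw [k₃', k₁'] at h02
  rw [k₂, k₁'] at h03
  set u : Fin 4 → H :=
    ![0, T 3 • b₂ - T 2 • b₃, T 1 • b₃ - T 3 • b₁, T 2 • b₁ - T 1 • b₂] with hu
  have u0 : u 0 = 0 := rfl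
  have u1 : u 1 = T 3 • b₂ - T 2 • b₃ := rfl
  have u2 : u 2 = T 1 • b₃ - T 3 • b₁ := rfl
  have u3 : u 3 = T 2 • b₁ - T 1 • b₂ := rfl
  have f01 : w 0 1 = P 0 • u 1 - P 1 • u 0 := by rw [h01, u0, u1]; module
  have f02 : w 0 2 = P 0 • u 2 - P 2 • u 0 := by rw [h02, u0, u2]; module
  have f03 : w 0 3 = P 0 • u 3 - P 3 • u 0 := by rw [h03, u0, u3]; module
  have f12 : w 1 2 = P 1 • u 2 - P 2 • u 1 := by
    rw [h12, u1, u2]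
    linear_combination (norm := module) -hTP' b₃ + T 3 • k₀
  have f13 : w 1 3 = P 1 • u 3 - P 3 • u 1 := by
    rw [h13, u1, u3]
    linear_combination (norm := module) hTP' b₂ - T 2 • k₀
  have f23 : w 2 3 = P 2 • u 3 - P 3 • u 2 := by
    rw [h23, u2, u3]
    linear_combination (norm := module) -hTP' b₁ + T 1 • k₀
  refine ⟨u, ?_, fun i j => ?_⟩
  · rw [Fin.sum_univ_four, u0, u1, u2, u3]
    module
  · have key : ∀ i j, w i j = P i • u j - P j • u i → w j i = P j • u i - P i • u j := by
      intro i j h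
      rw [hw, h, neg_sub]
    fin_cases i <;> fin_cases j <;>
      first
      | exact (hw0 _).trans (sub_self _).symm
      | assumption
      | exact key _ _ (by assumption)

theorem alternating_ext {t : Fin 4 → Fin 4 → Fin 4 → H} (h0 : ∀ i j, t i i j = 0)
    (h1 : ∀ i j k, t i j k = -t j i k) (h2 : ∀ i j k, t i j k = -t i k j)
    (h012 : t 0 1 2 = 0) (h013 : t 0 1 3 = 0) (h023 : t 0 2 3 = 0) (h123 : t 1 2 3 = 0)
    (i j k : Fin 4) : t i j k = 0 := by
  have h0' : ∀ i j, t i j j = 0 := fun i j => by rw [h1, h2, h0, neg_zero, neg_zero]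
  have h0'' : ∀ i j, t i j i = 0 := fun i j => by rw [h1, h0', neg_zero]
  have p1 : ∀ i j k, t i j k = 0 → t j i k = 0 := fun i j k h => by rw [h1, h, neg_zero]
  have p2 : ∀ i j k, t i j k = 0 → t i k j = 0 := fun i j k h => by rw [h2, h, neg_zero]
  fin_cases i <;> fin_cases j <;> fin_cases k <;>
    first
    | exact h0 _ _
    | exact h0' _ _
    | exact h0'' _ _
    | assumption
    | exact p1 _ _ _ (by assumption)
    | exact p2 _ _ _ (by assumption)
    | exact p1 _ _ _ (p2 _ _ _ (by assumption))
    | exact p2 _ _ _ (p1 _ _ _ (by assumption))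
    | exact p1 _ _ _ (p2 _ _ _ (p1 _ _ _ (by assumption)))

/-- Exactness at `𝒱₃`. -/
theorem exact_at_three (hTP : P 0 * T 0 + P 1 * T 1 + P 2 * T 2 + P 3 * T 3 = 0)
    (hP : ∀ v : H, ∃ u : H, P 0 • u = v)
    (hgrad : ∀ g : Fin 4 → H, (∀ i j, T i • g j = T j • g i) → ∃ G : H, ∀ i, T i • G = g i)
    (t : Fin 4 → Fin 4 → Fin 4 → H) (h0 : ∀ i j, t i i j = 0)
    (h1 : ∀ i j k, t i j k = -t j i k) (h2 : ∀ i j k, t i j k = -t i k j)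
    (hC : ∀ j k, ∑ i, T i • t i j k = 0) :
    ∃ w : Fin 4 → Fin 4 → H, (∀ i, w i i = 0) ∧ (∀ i j, w i j = -w j i) ∧
      (∀ j, ∑ i, T i • w i j = 0) ∧
      ∀ i j k, t i j k = P i • w j k + P j • w k i + P k • w i j := by
  have h0' : ∀ i j, t i j j = 0 := fun i j => by rw [h1, h2, h0, neg_zero, neg_zero]
  have hTP' : ∀ y : H, (P 0 * T 0 + P 1 * T 1 + P 2 * T 2 + P 3 * T 3) • y = 0 := by simp [hTP]
  have rot : ∀ i j k, t i j k = t k i j := fun i j k => by rw [h2, h1, neg_neg]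
  have e01 := hC 0 1
  have e02 := hC 0 2
  have e03 := hC 0 3
  have e12 := hC 1 2
  have e13 := hC 1 3
  have e23 := hC 2 3
  simp only [Fin.sum_univ_four, h0, h1 1 0 1, h0', h1 2 0 2, h1 3 0 3, h1 2 1 2, h1 3 1 3,
    h1 3 2 3, rot 2 0 1, rot 3 0 1, rot 3 0 2, rot 1 2 0, rot 3 1 2, rot 1 3 0, rot 2 3 0,
    rot 2 3 1, h1 1 0 2, h1 1 0 3, h1 2 0 3, h1 2 1 3, smul_zero, neg_zero, add_zero, zero_add]
    at e01 e02 e03 e12 e13 e23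
  have f01 : T 0 • t 0 2 3 = T 1 • -t 1 2 3 := by linear_combination (norm := module) e23
  have f02 : T 0 • -t 0 1 3 = T 2 • -t 1 2 3 := by linear_combination (norm := module) -e13
  have f03 : T 0 • t 0 1 2 = T 3 • -t 1 2 3 := by linear_combination (norm := module) e12
  have f12 : T 1 • -t 0 1 3 = T 2 • t 0 2 3 := by linear_combination (norm := module) e03
  have f13 : T 1 • t 0 1 2 = T 3 • t 0 2 3 := by linear_combination (norm := module) -e02
  have f23 : T 2 • t 0 1 2 = T 3 • -t 0 1 3 := by linear_combination (norm := module) e01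
  obtain ⟨G, hG⟩ := hgrad ![-t 1 2 3, t 0 2 3, -t 0 1 3, t 0 1 2] (by
    intro i j
    fin_cases i <;> fin_cases j <;>
      first
      | rfl
      | assumption
      | exact Eq.symm (by assumption))
  have g0 : T 0 • G = -t 1 2 3 := hG 0
  have g1 : T 1 • G = t 0 2 3 := hG 1
  have g2 : T 2 • G = -t 0 1 3 := hG 2
  have g3 : T 3 • G = t 0 1 2 := hG 3
  obtain ⟨η, rfl⟩ := hP G
  -- This is ι_T(η e₁₂₃); then P∧w = -ι_T(P₀η vol), whose components are those of t.
  set w : Fin 4 → Fin 4 → H := ![![0, 0, 0, 0], ![0, 0, T 3 • η, -(T 2 • η)],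
    ![0, -(T 3 • η), 0, T 1 • η], ![0, T 2 • η, -(T 1 • η), 0]] with hwdef
  have hw0 : ∀ i, w i i = 0 := by
    intro i; fin_cases i <;> rfl
  have hw : ∀ i j, w i j = -w j i := by
    intro i j
    fin_cases i <;> fin_cases j <;> simp [hwdef]
  refine ⟨w, hw0, hw, ?_, fun i j k => ?_⟩
  · intro j
    fin_cases j <;> simp only [hwdef, Fin.sum_univ_four, Fin.mk_one, Fin.zero_eta, Fin.reduceFinMk,
      Matrix.cons_val] <;> module
  · rw [← sub_eq_zero]
    refine alternating_ext (t := fun i j k => t i j k - (P i • w j k + P j • w k i + P k • w i j))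
      ?_ ?_ ?_ ?_ ?_ ?_ ?_ i j k
    · intro i j
      simp only [h0, hw0, hw j i]
      module
    · intro i j k
      simp only [h1 j i k, hw k i, hw j k, hw i j]
      module
    · intro i j k
      simp only [h2 i k j, hw k i, hw k j, hw j i]
      module
    · change t 0 1 2 - (P 0 • (T 3 • η) + P 1 • (0 : H) + P 2 • (0 : H)) = 0
      linear_combination (norm := module) -g3
    · change t 0 1 3 - (P 0 • (-(T 2 • η)) + P 1 • (0 : H) + P 3 • (0 : H)) = 0
      linear_combination (norm := module) g2
    · change t 0 2 3 - (P 0 • (T 1 • η) + P 2 • (0 : H) + P 3 • (0 : H)) = 0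
      linear_combination (norm := module) -g1
    · change t 1 2 3 - (P 1 • (T 1 • η) + P 2 • (T 2 • η) + P 3 • (T 3 • η)) = 0
      linear_combination (norm := module) g0 - hTP' η

end Koszul

/-! ### Solving equations by leading terms of a filtration -/

section Filtration

variable {R H : Type*} [CommRing R] [AddCommGroup H] [Module R H]

/-- `J` is a right inverse of the part `M` of lowest order of `p` with respect to the increasing
filtration `F`: the operator `M` lowers the filtration by `w`, while `p - M` lowers it by more. -/
structure LeadingInverse (F : ℤ → AddSubgroup H) (p M : R) (J : H → H) (w : ℤ) : Prop where
  right_inv : ∀ v, M • J v = v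
  inv_mem : ∀ n, ∀ v ∈ F n, J v ∈ F (n + w)
  lead_mem : ∀ n, ∀ v ∈ F n, M • v ∈ F (n - w)
  rest_mem : ∀ n, ∀ v ∈ F n, (p - M) • v ∈ F (n - w - 1)

variable {F : ℤ → AddSubgroup H}

theorem LeadingInverse.smul_mem (hF : Monotone F) {p M : R} {J : H → H} {w : ℤ}
    (h : LeadingInverse F p M J w) {n : ℤ} {v : H} (hv : v ∈ F n) : p • v ∈ F (n - w) := by
  have : p • v = M • v + (p - M) • v := by module
  rw [this]
  exact add_mem (h.lead_mem n v hv) (hF (by omega) (h.rest_mem n v hv))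

/-- Solvability of `p u = v` up to lower order terms implies solvability. -/
theorem solve_of_step (hF : Monotone F) (hF0 : ∀ n ≤ 0, F n = ⊥) (S : Submodule R H) {p : R}
    {w : ℤ} (hstep : ∀ n, ∀ v ∈ F n, v ∈ S → ∃ u ∈ F (n + w), u ∈ S ∧ v - p • u ∈ F (n - 1))
    (n : ℤ) (v : H) (hv : v ∈ F n) (hvS : v ∈ S) : ∃ u ∈ F (n + w), u ∈ S ∧ p • u = v := by
  obtain ⟨k, hk⟩ : ∃ k : ℕ, n ≤ k := ⟨n.toNat, Int.self_le_toNat n⟩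
  induction k generalizing n v with
  | zero =>
    rw [hF0 n (by simpa using hk), AddSubgroup.mem_bot] at hv
    exact ⟨0, zero_mem _, zero_mem _, by rw [hv, smul_zero]⟩
  | succ k ih =>
    obtain ⟨u, hu, huS, h⟩ := hstep n v hv hvS
    obtain ⟨u', hu', huS', h'⟩ := ih (n - 1) _ h (S.sub_mem hvS (S.smul_mem _ huS))
      (by push_cast at hk; omega)
    exact ⟨u + u', add_mem hu (hF (by omega) hu'), S.add_mem huS huS', by
      rw [smul_add, h', add_sub_cancel]⟩

variable {p₀ p₁ p₂ M₀ M₁ M₂ : R} {J₀ J₁ J₂ : H → H} {w₀ w₁ w₂ : ℤ}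

/-- J₀v solves the equation up to -(p₀ - M₀)J₀v, which lies one step lower. -/
theorem solve_first (hF : Monotone F) (hF0 : ∀ n ≤ 0, F n = ⊥)
    (h₀ : LeadingInverse F p₀ M₀ J₀ w₀) (n : ℤ) (v : H) (hv : v ∈ F n) :
    ∃ u ∈ F (n + w₀), p₀ • u = v := by
  obtain ⟨u, hu, -, h⟩ := solve_of_step (p := p₀) (w := w₀) hF hF0 ⊤ (fun n v hv _ => by
    refine ⟨J₀ v, h₀.inv_mem n v hv, trivial, ?_⟩
    have h := neg_mem (h₀.rest_mem _ _ (h₀.inv_mem n v hv))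
    have e : v - p₀ • J₀ v = -((p₀ - M₀) • J₀ v) := by
      linear_combination (norm := module) -h₀.right_inv v
    rw [e]
    exact hF (by omega) h) n v hv trivial
  exact ⟨u, hu, h⟩

/-- J₁v solves the second equation to leading order but need not stay in the kernel of p₀; a
correction of lower order, found by `solve_first`, puts it back there. -/
theorem solve_second (hF : Monotone F) (hF0 : ∀ n ≤ 0, F n = ⊥)
    (h₀ : LeadingInverse F p₀ M₀ J₀ w₀) (h₁ : LeadingInverse F p₁ M₁ J₁ w₁)
    (hJ₁ : ∀ u v, J₁ (u + v) = J₁ u + J₁ v)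
    (c₀₁ : ∀ v, M₀ • J₁ v = J₁ (M₀ • v)) (n : ℤ) (v : H) (hv : v ∈ F n) (hv₀ : p₀ • v = 0) :
    ∃ u ∈ F (n + w₁), p₀ • u = 0 ∧ p₁ • u = v := by
  suffices hstep : ∀ n, ∀ v ∈ F n, v ∈ LinearMap.ker (LinearMap.lsmul R H p₀) →
      ∃ u ∈ F (n + w₁), u ∈ LinearMap.ker (LinearMap.lsmul R H p₀) ∧ v - p₁ • u ∈ F (n - 1) from
    solve_of_step hF hF0 _ hstep n v hv hv₀
  intro n v hv hv₀
  replace hv₀ : p₀ • v = 0 := hv₀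
  set J : H →+ H := AddMonoidHom.mk' J₁ hJ₁
  have hM : M₀ • v = -((p₀ - M₀) • v) := by linear_combination (norm := module) hv₀
  have hJM : J₁ (M₀ • v) = -J₁ ((p₀ - M₀) • v) := by rw [hM]; exact map_neg J _
  -- On the kernel of p₀ the leading part M₀ equals -(p₀ - M₀). Moving M₀ past J₁ thus gains one
  -- step of the filtration.
  have hr : p₀ • J₁ v ∈ F (n + w₁ - w₀ - 1) := by
    have e : p₀ • J₁ v = -J₁ ((p₀ - M₀) • v) + (p₀ - M₀) • J₁ v := by
      linear_combination (norm := module) c₀₁ v + hJM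
    rw [e]
    exact add_mem (neg_mem (hF (by omega) (h₁.inv_mem _ _ (h₀.rest_mem _ _ hv))))
      (h₀.rest_mem _ _ (h₁.inv_mem _ _ hv))
  obtain ⟨t, ht, ht'⟩ := solve_first hF hF0 h₀ _ _ hr
  refine ⟨J₁ v - t, sub_mem (h₁.inv_mem _ _ hv) (hF (by omega) ht), ?_, ?_⟩
  · change p₀ • (J₁ v - t) = 0
    linear_combination (norm := module) -ht'
  · have e : v - p₁ • (J₁ v - t) = p₁ • t - (p₁ - M₁) • J₁ v := by
      linear_combination (norm := module) -h₁.right_inv v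
    rw [e]
    exact sub_mem (hF (by omega) (h₁.smul_mem hF ht))
      (hF (by omega) (h₁.rest_mem _ _ (h₁.inv_mem _ _ hv)))

/-- J₂v is corrected twice: t restores the kernel of p₀, and s, taken inside that kernel, restores
the kernel of p₁. Both lie one step below J₂v, so the leading order of p₂J₂v is unaffected. -/
theorem solve_third (hF : Monotone F) (hF0 : ∀ n ≤ 0, F n = ⊥)
    (h₀ : LeadingInverse F p₀ M₀ J₀ w₀) (h₁ : LeadingInverse F p₁ M₁ J₁ w₁)
    (h₂ : LeadingInverse F p₂ M₂ J₂ w₂)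
    (hJ₁ : ∀ u v, J₁ (u + v) = J₁ u + J₁ v) (hJ₂ : ∀ u v, J₂ (u + v) = J₂ u + J₂ v)
    (c₀₁ : ∀ v, M₀ • J₁ v = J₁ (M₀ • v)) (c₀₂ : ∀ v, M₀ • J₂ v = J₂ (M₀ • v))
    (c₁₂ : ∀ v, M₁ • J₂ v = J₂ (M₁ • v))
    (n : ℤ) (v : H) (hv : v ∈ F n) (hv₀ : p₀ • v = 0) (hv₁ : p₁ • v = 0) :
    ∃ u ∈ F (n + w₂), p₀ • u = 0 ∧ p₁ • u = 0 ∧ p₂ • u = v := by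
  set S := LinearMap.ker (LinearMap.lsmul R H p₀) ⊓ LinearMap.ker (LinearMap.lsmul R H p₁)
  suffices hstep : ∀ n, ∀ v ∈ F n, v ∈ S → ∃ u ∈ F (n + w₂), u ∈ S ∧ v - p₂ • u ∈ F (n - 1) by
    obtain ⟨u, hu, ⟨hu₀, hu₁⟩, h⟩ := solve_of_step hF hF0 S hstep n v hv ⟨hv₀, hv₁⟩
    exact ⟨u, hu, hu₀, hu₁, h⟩
  intro n v hv hvS
  have hv₀ : p₀ • v = 0 := hvS.1
  have hv₁ : p₁ • v = 0 := hvS.2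
  set J : H →+ H := AddMonoidHom.mk' J₂ hJ₂
  have hM₀ : M₀ • v = -((p₀ - M₀) • v) := by linear_combination (norm := module) hv₀
  have hM₁ : M₁ • v = -((p₁ - M₁) • v) := by linear_combination (norm := module) hv₁
  have hJM₀ : J₂ (M₀ • v) = -J₂ ((p₀ - M₀) • v) := by rw [hM₀]; exact map_neg J _
  have hJM₁ : J₂ (M₁ • v) = -J₂ ((p₁ - M₁) • v) := by rw [hM₁]; exact map_neg J _
  have hr₀ : p₀ • J₂ v ∈ F (n + w₂ - w₀ - 1) := by
    have e : p₀ • J₂ v = -J₂ ((p₀ - M₀) • v) + (p₀ - M₀) • J₂ v := by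
      linear_combination (norm := module) c₀₂ v + hJM₀
    rw [e]
    exact add_mem (neg_mem (hF (by omega) (h₂.inv_mem _ _ (h₀.rest_mem _ _ hv))))
      (h₀.rest_mem _ _ (h₂.inv_mem _ _ hv))
  have hr₁ : p₁ • J₂ v ∈ F (n + w₂ - w₁ - 1) := by
    have e : p₁ • J₂ v = -J₂ ((p₁ - M₁) • v) + (p₁ - M₁) • J₂ v := by
      linear_combination (norm := module) c₁₂ v + hJM₁
    rw [e]
    exact add_mem (neg_mem (hF (by omega) (h₂.inv_mem _ _ (h₁.rest_mem _ _ hv))))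
      (h₁.rest_mem _ _ (h₂.inv_mem _ _ hv))
  obtain ⟨t, ht, ht₀⟩ := solve_first hF hF0 h₀ _ _ hr₀
  obtain ⟨s, hs, hs₀, hs₁⟩ := solve_second hF hF0 h₀ h₁ hJ₁ c₀₁ (n + w₂ - w₁ - 1)
    (p₁ • J₂ v - p₁ • t) (sub_mem hr₁ (hF (by omega) (h₁.smul_mem hF ht)))
    (by linear_combination (norm := module) -p₁ • ht₀)
  refine ⟨J₂ v - t - s, sub_mem (sub_mem (h₂.inv_mem _ _ hv) (hF (by omega) ht))
    (hF (by omega) hs), ⟨?_, ?_⟩, ?_⟩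
  · change p₀ • (J₂ v - t - s) = 0
    linear_combination (norm := module) -ht₀ - hs₀
  · change p₁ • (J₂ v - t - s) = 0
    linear_combination (norm := module) -hs₁
  · have e : v - p₂ • (J₂ v - t - s) = p₂ • t + p₂ • s - (p₂ - M₂) • J₂ v := by
      linear_combination (norm := module) -h₂.right_inv v
    rw [e]
    exact sub_mem (add_mem (hF (by omega) (h₂.smul_mem hF ht)) (hF (by omega) (h₂.smul_mem hF hs)))
      (hF (by omega) (h₂.rest_mem _ _ (h₂.inv_mem _ _ hv)))

end Filtration

/-! ### Symmetric families and their commutative ring of operators -/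

/-- Complex polynomials in six variables. -/
abbrev Poly : Type := MvPolynomial (Fin 6) ℂ

/-- Families of symmetric tensors of all degrees with polynomial coefficients: `c m` is the
component whose lower indices form the multiset `m`. -/
abbrev Sec : Type := Multiset (Fin 4) → Poly

/-- Fixing one lower index. -/
def shift (i : Fin 4) : Module.End ℂ Sec := LinearMap.funLeft ℂ Poly (fun m => i ::ₘ m)

/-- Differentiation of the coefficients. -/
def der (j : Fin 6) : Module.End ℂ Sec :=
  LinearMap.compLeft (MvPolynomial.pderiv j).toLinearMap (Multiset (Fin 4))

theorem pderiv_comm (i j : Fin 6) (φ : Poly) :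
    MvPolynomial.pderiv i (MvPolynomial.pderiv j φ) =
      MvPolynomial.pderiv j (MvPolynomial.pderiv i φ) := by
  classical
  induction φ using MvPolynomial.induction_on with
  | C a => simp
  | add p q hp hq => simp only [map_add, hp, hq]
  | mul_X p k hp =>
    simp only [MvPolynomial.pderiv_mul, map_add, hp, MvPolynomial.pderiv_X, Pi.single_apply]
    split_ifs <;> simp [add_right_comm]

/-- The shifts and the derivations. -/
def opSet : Set (Module.End ℂ Sec) := Set.range shift ∪ Set.range der

theorem opSet_comm : ∀ a ∈ opSet, ∀ b ∈ opSet, a * b = b * a := by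
  rintro _ (⟨i, rfl⟩ | ⟨i, rfl⟩) _ (⟨j, rfl⟩ | ⟨j, rfl⟩)
  · refine LinearMap.ext fun c => funext fun m => ?_
    exact congrArg c (Multiset.cons_swap _ _ _)
  · rfl
  · rfl
  · refine LinearMap.ext fun c => funext fun m => ?_
    exact pderiv_comm i j (c m)

/-- The commutative ring of operators that is generated by the shifts and the derivations. -/
def OpRing : Type := Algebra.adjoin ℂ opSet

instance : Ring OpRing := inferInstanceAs (Ring (Algebra.adjoin ℂ opSet))

instance : CommRing OpRing where
  mul_comm := (Algebra.isMulCommutative_adjoin ℂ opSet_comm).is_comm.comm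

instance : Module OpRing Sec := inferInstanceAs (Module (Algebra.adjoin ℂ opSet) Sec)

/-- The shifts as elements of the ring of operators. -/
def opT (i : Fin 4) : OpRing := ⟨shift i, Algebra.subset_adjoin (Or.inl ⟨i, rfl⟩)⟩

/-- The derivations as elements of the ring of operators. -/
def opX (j : Fin 6) : OpRing := ⟨der j, Algebra.subset_adjoin (Or.inr ⟨j, rfl⟩)⟩

theorem opT_smul (i : Fin 4) (c : Sec) (m : Multiset (Fin 4)) : (opT i • c) m = c (i ::ₘ m) := rfl

theorem opX_smul (j : Fin 6) (c : Sec) (m : Multiset (Fin 4)) :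
    (opX j • c) m = MvPolynomial.pderiv j (c m) := rfl

/-- The matrix `(∇^{AB})` of derivations. -/
def opNabla : Fin 4 → Fin 4 → OpRing :=
  ![![0, opX 0, opX 1, opX 2], ![-opX 0, 0, opX 3, opX 4],
    ![-opX 1, -opX 3, 0, opX 5], ![-opX 2, -opX 4, -opX 5, 0]]

/-- The matrix `(∇^{AB})` acting on polynomials. -/
def polyNabla : Fin 4 → Fin 4 → Module.End ℂ Poly :=
  let d (j : Fin 6) : Module.End ℂ Poly := (MvPolynomial.pderiv j).toLinearMap
  ![![0, d 0, d 1, d 2], ![-d 0, 0, d 3, d 4], ![-d 1, -d 3, 0, d 5], ![-d 2, -d 4, -d 5, 0]]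

/-- The operator `∑_B ∇^{BA} T_B`. -/
def opP (A : Fin 4) : OpRing := ∑ B, opNabla B A * opT B

theorem opNabla_smul (A B : Fin 4) (c : Sec) (m : Multiset (Fin 4)) :
    (opNabla A B • c) m = polyNabla A B (c m) := by
  fin_cases A <;> fin_cases B <;>
    first
    | exact congrFun (zero_smul OpRing c) m
    | rfl

theorem opP_smul (A : Fin 4) (c : Sec) (m : Multiset (Fin 4)) :
    (opP A • c) m = ∑ B, polyNabla B A (c (B ::ₘ m)) := by
  simp only [opP, Finset.sum_smul, Finset.sum_apply, mul_smul, opNabla_smul, opT_smul]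

/-- The antisymmetric ∇^{BA} is summed against the symmetric T_B T_A. -/
theorem opP_opT : opP 0 * opT 0 + opP 1 * opT 1 + opP 2 * opT 2 + opP 3 * opT 3 = 0 := by
  simp only [opP, Fin.sum_univ_four, opNabla, Matrix.cons_val]
  ring

theorem opP_zero : opP 0 = -(opX 0 * opT 1) - opX 1 * opT 2 - opX 2 * opT 3 := by
  simp only [opP, Fin.sum_univ_four, opNabla, Matrix.cons_val]
  ring

theorem opP_one : opP 1 = opX 0 * opT 0 - opX 3 * opT 2 - opX 4 * opT 3 := by
  simp only [opP, Fin.sum_univ_four, opNabla, Matrix.cons_val]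
  ring

theorem opP_two : opP 2 = opX 1 * opT 0 + opX 3 * opT 1 - opX 5 * opT 3 := by
  simp only [opP, Fin.sum_univ_four, opNabla, Matrix.cons_val]
  ring

/-! ### The weight filtration and coregularity of P -/

/-- The antiderivative in one variable. -/
def antideriv (j : Fin 6) : Module.End ℂ Poly :=
  (MvPolynomial.basisMonomials (Fin 6) ℂ).constr ℂ fun α =>
    MvPolynomial.monomial (α + Finsupp.single j 1) ((α j + 1 : ℂ)⁻¹)

theorem antideriv_monomial (j : Fin 6) (α : Fin 6 →₀ ℕ) (r : ℂ) :
    antideriv j (MvPolynomial.monomial α r) =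
      MvPolynomial.monomial (α + Finsupp.single j 1) (r * (α j + 1 : ℂ)⁻¹) := by
  have h : MvPolynomial.monomial α r = r • MvPolynomial.basisMonomials (Fin 6) ℂ α := by
    simp [MvPolynomial.smul_monomial]
  rw [h, map_smul, antideriv, Module.Basis.constr_basis, MvPolynomial.smul_monomial, smul_eq_mul]

theorem pderiv_antideriv (j : Fin 6) (φ : Poly) : MvPolynomial.pderiv j (antideriv j φ) = φ := by
  induction φ using MvPolynomial.induction_on' with
  | monomial α r =>
    have : (α j + 1 : ℂ) ≠ 0 := by exact_mod_cast Nat.succ_ne_zero (α j)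
    rw [antideriv_monomial, MvPolynomial.pderiv_monomial]
    simp [this]
  | add p q hp hq => rw [map_add, map_add, hp, hq]

theorem pderiv_antideriv_comm {i j : Fin 6} (hij : i ≠ j) (φ : Poly) :
    MvPolynomial.pderiv i (antideriv j φ) = antideriv j (MvPolynomial.pderiv i φ) := by
  induction φ using MvPolynomial.induction_on' with
  | monomial α r =>
    rw [antideriv_monomial, MvPolynomial.pderiv_monomial, MvPolynomial.pderiv_monomial,
      antideriv_monomial]
    have h1 : (α - Finsupp.single i 1 : Fin 6 →₀ ℕ) j = α j := by simp [hij]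
    have h2 : (α + Finsupp.single j 1 : Fin 6 →₀ ℕ) i = α i := by simp [hij]
    rw [h1, h2, mul_right_comm]
    by_cases h : α i = 0
    · simp [h]
    · have e : α + Finsupp.single j 1 - Finsupp.single i 1 =
          α - Finsupp.single i 1 + Finsupp.single j 1 := by
        refine tsub_add_eq_add_tsub (Finsupp.single_le_iff.2 (Nat.one_le_iff_ne_zero.2 h)) |>.symm
      rw [e]
  | add p q hp hq => simp only [map_add, hp, hq]

/-- The weights of the six variables. -/
def varWeight : Fin 6 → ℕ := ![3, 1, 0, 1, 3, 3]

/-- The weights of the four lower indices. -/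
def idxWeight : Fin 4 → ℕ := ![2, 3, 3, 3]

/-- Polynomials all of whose monomials have weight less than `n`. -/
def polyFil (n : ℤ) : Submodule ℂ Poly :=
  Submodule.span ℂ {φ | ∃ α r, φ = MvPolynomial.monomial α r ∧
    (Finsupp.weight varWeight α : ℤ) < n}

theorem polyFil_mono : Monotone polyFil := fun _ _ h =>
  Submodule.span_mono fun _ ⟨α, r, hφ, hα⟩ => ⟨α, r, hφ, hα.trans_le h⟩

theorem polyFil_eq_bot {n : ℤ} (hn : n ≤ 0) : polyFil n = ⊥ := by
  rw [polyFil, Submodule.span_eq_bot]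
  rintro _ ⟨α, r, -, hα⟩
  omega

theorem exists_mem_polyFil (φ : Poly) : ∃ n : ℕ, φ ∈ polyFil n := by
  induction φ using MvPolynomial.induction_on' with
  | monomial α r =>
    exact ⟨Finsupp.weight varWeight α + 1, Submodule.subset_span ⟨α, r, rfl, by push_cast; omega⟩⟩
  | add p q hp hq =>
    obtain ⟨a, ha⟩ := hp
    obtain ⟨b, hb⟩ := hq
    exact ⟨a + b, add_mem (polyFil_mono (by push_cast; omega) ha)
      (polyFil_mono (by push_cast; omega) hb)⟩

theorem pderiv_mem_polyFil (j : Fin 6) {n : ℤ} {φ : Poly} (hφ : φ ∈ polyFil n) :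
    MvPolynomial.pderiv j φ ∈ polyFil (n - varWeight j) := by
  suffices polyFil n ≤ (polyFil (n - varWeight j)).comap (MvPolynomial.pderiv j).toLinearMap from
    this hφ
  refine Submodule.span_le.2 ?_
  rintro _ ⟨α, r, rfl, hα⟩
  change MvPolynomial.pderiv j (MvPolynomial.monomial α r) ∈ polyFil _
  rw [MvPolynomial.pderiv_monomial]
  by_cases h : α j = 0
  · simp [h]
  · refine Submodule.subset_span ⟨_, _, rfl, ?_⟩
    have e : α = (α - Finsupp.single j 1) + Finsupp.single j 1 := by
      rw [tsub_add_cancel_of_le]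
      exact Finsupp.single_le_iff.2 (Nat.one_le_iff_ne_zero.2 h)
    rw [e, map_add, Finsupp.weight_single, one_smul] at hα
    push_cast at hα
    omega

theorem antideriv_mem_polyFil (j : Fin 6) {n : ℤ} {φ : Poly} (hφ : φ ∈ polyFil n) :
    antideriv j φ ∈ polyFil (n + varWeight j) := by
  suffices polyFil n ≤ (polyFil (n + varWeight j)).comap (antideriv j) from this hφ
  refine Submodule.span_le.2 ?_
  rintro _ ⟨α, r, rfl, hα⟩
  change antideriv j (MvPolynomial.monomial α r) ∈ polyFil _
  rw [antideriv_monomial]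
  refine Submodule.subset_span ⟨_, _, rfl, ?_⟩
  rw [map_add, Finsupp.weight_single, one_smul]
  push_cast
  omega

/-- The filtration by weight. -/
def secFil (n : ℤ) : AddSubgroup Sec :=
  AddSubgroup.pi Set.univ fun m => (polyFil (n - (m.map idxWeight).sum)).toAddSubgroup

theorem mem_secFil {n : ℤ} {c : Sec} :
    c ∈ secFil n ↔ ∀ m, c m ∈ polyFil (n - (m.map idxWeight).sum) := by
  simp [secFil, AddSubgroup.mem_pi]

theorem secFil_mono : Monotone secFil := fun _ _ h _ hc =>
  mem_secFil.2 fun m => polyFil_mono (by omega) (mem_secFil.1 hc m)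

theorem secFil_eq_bot (n : ℤ) (hn : n ≤ 0) : secFil n = ⊥ := by
  rw [eq_bot_iff]
  intro c hc
  refine funext fun m => ?_
  have := mem_secFil.1 hc m
  rwa [polyFil_eq_bot (by omega), Submodule.mem_bot] at this

theorem opXT_smul_mem (j : Fin 6) (i : Fin 4) {n : ℤ} {c : Sec} (hc : c ∈ secFil n) :
    (opX j * opT i) • c ∈ secFil (n - (varWeight j + idxWeight i)) := by
  refine mem_secFil.2 fun m => ?_
  rw [mul_smul, opX_smul, opT_smul]
  have := pderiv_mem_polyFil j (mem_secFil.1 hc (i ::ₘ m))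
  rw [Multiset.map_cons, Multiset.sum_cons] at this
  refine polyFil_mono ?_ this
  push_cast
  omega

/-- A right inverse of the operator `X_j T_i`. -/
def rightInv (j : Fin 6) (i : Fin 4) (c : Sec) : Sec :=
  fun m => if i ∈ m then antideriv j (c (m.erase i)) else 0

theorem rightInv_add (j : Fin 6) (i : Fin 4) (c d : Sec) :
    rightInv j i (c + d) = rightInv j i c + rightInv j i d := by
  funext m
  by_cases h : i ∈ m <;> simp [rightInv, h]

theorem smul_rightInv (j : Fin 6) (i : Fin 4) (c : Sec) :
    (opX j * opT i) • rightInv j i c = c := by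
  funext m
  rw [mul_smul, opX_smul, opT_smul, rightInv, if_pos (Multiset.mem_cons_self i m),
    Multiset.erase_cons_head, pderiv_antideriv]

/-- Distinct variables and distinct indices do not interact; this is why the leading terms must
share neither. -/
theorem smul_rightInv_comm {j j' : Fin 6} (hj : j ≠ j') {i i' : Fin 4} (hi : i ≠ i') (c : Sec) :
    (opX j * opT i) • rightInv j' i' c = rightInv j' i' ((opX j * opT i) • c) := by
  funext m
  simp only [mul_smul, opX_smul, opT_smul, rightInv, Multiset.mem_cons, hi.symm, false_or]
  split_ifs with h
  · rw [pderiv_antideriv_comm hj, Multiset.erase_cons_tail _ hi]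
  · exact map_zero _

theorem rightInv_mem (j : Fin 6) (i : Fin 4) {n : ℤ} {c : Sec} (hc : c ∈ secFil n) :
    rightInv j i c ∈ secFil (n + (varWeight j + idxWeight i)) := by
  refine mem_secFil.2 fun m => ?_
  simp only [rightInv]
  split_ifs with h
  · have := antideriv_mem_polyFil j (mem_secFil.1 hc (m.erase i))
    obtain ⟨m', rfl⟩ := Multiset.exists_cons_of_mem h
    rw [Multiset.erase_cons_head] at this ⊢
    refine polyFil_mono ?_ this
    rw [Multiset.map_cons, Multiset.sum_cons]
    push_cast
    omega
  · exact zero_mem _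

theorem leadingInverse {p : OpRing} {j : Fin 6} {i : Fin 4} {w : ℤ}
    (hw : varWeight j + idxWeight i = w)
    (h : ∀ n, ∀ c ∈ secFil n, (p - opX j * opT i) • c ∈ secFil (n - w - 1)) :
    LeadingInverse secFil p (opX j * opT i) (rightInv j i) w where
  right_inv := smul_rightInv j i
  inv_mem n c hc := by rw [← hw]; exact rightInv_mem j i hc
  lead_mem n c hc := by rw [← hw]; exact opXT_smul_mem j i hc
  rest_mem := h

/-- The weights make X₂T₃ (3) lighter than X₁T₂ (4) and X₀T₁ (6). Likewise X₃T₂ (4) is the lightest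
term of P₁, against X₀T₀ (5) and X₄T₃ (6), and X₁T₀ (3) that of P₂, against X₃T₁ (4) and X₅T₃ (6).
-/
theorem leadingInverse_zero :
    LeadingInverse secFil (-opP 0) (opX 2 * opT 3) (rightInv 2 3) 3 := by
  refine leadingInverse rfl fun n c hc => ?_
  have e : (-opP 0 - opX 2 * opT 3) • c = (opX 0 * opT 1) • c + (opX 1 * opT 2) • c := by
    rw [opP_zero]; module
  rw [e]
  exact add_mem (secFil_mono (by simp [varWeight, idxWeight]; try omega) (opXT_smul_mem 0 1 hc))
    (secFil_mono (by simp [varWeight, idxWeight]; try omega) (opXT_smul_mem 1 2 hc))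

theorem leadingInverse_one :
    LeadingInverse secFil (-opP 1) (opX 3 * opT 2) (rightInv 3 2) 4 := by
  refine leadingInverse rfl fun n c hc => ?_
  have e : (-opP 1 - opX 3 * opT 2) • c = -((opX 0 * opT 0) • c) + (opX 4 * opT 3) • c := by
    rw [opP_one]; module
  rw [e]
  exact add_mem (neg_mem (secFil_mono (by simp [varWeight, idxWeight]; try omega)
      (opXT_smul_mem 0 0 hc)))
    (secFil_mono (by simp [varWeight, idxWeight]; try omega) (opXT_smul_mem 4 3 hc))

theorem leadingInverse_two :
    LeadingInverse secFil (opP 2) (opX 1 * opT 0) (rightInv 1 0) 3 := by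
  refine leadingInverse rfl fun n c hc => ?_
  have e : (opP 2 - opX 1 * opT 0) • c = (opX 3 * opT 1) • c - (opX 5 * opT 3) • c := by
    rw [opP_two]; module
  rw [e]
  exact sub_mem (secFil_mono (by simp [varWeight, idxWeight]; try omega) (opXT_smul_mem 3 1 hc))
    (secFil_mono (by simp [varWeight, idxWeight]; try omega) (opXT_smul_mem 5 3 hc))

/-- The part of degree `n` of a family of tensors. -/
def cutoff (n : ℕ) (c : Sec) : Sec := fun m => if m.card = n then c m else 0

theorem opP_smul_cutoff (A : Fin 4) (n : ℕ) (c : Sec) :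
    opP A • cutoff (n + 1) c = cutoff n (opP A • c) := by
  funext m
  simp only [cutoff, opP_smul, Multiset.card_cons, Nat.add_right_cancel_iff]
  split_ifs <;> simp

theorem opP_smul_cutoff_zero (A : Fin 4) (c : Sec) : opP A • cutoff 0 c = 0 := by
  funext m
  simp [cutoff, opP_smul]

theorem opT_smul_cutoff (i : Fin 4) (n : ℕ) (c : Sec) :
    opT i • cutoff (n + 1) c = cutoff n (opT i • c) := by
  funext m
  simp only [cutoff, opT_smul, Multiset.card_cons, Nat.add_right_cancel_iff]

/-- Only finitely many multisets have a given size. A family with components in all degrees may lie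
in no step of the filtration, so equations are solved degree by degree. -/
theorem exists_cutoff_mem_secFil (n : ℕ) (c : Sec) : ∃ N : ℤ, cutoff n c ∈ secFil N := by
  choose d hd using fun s : Sym (Fin 4) n => exists_mem_polyFil (c s.1)
  set f : Sym (Fin 4) n → ℤ := fun s => d s + (s.1.map idxWeight).sum with hf
  refine ⟨∑ s, f s, mem_secFil.2 fun m => ?_⟩
  simp only [cutoff]
  split_ifs with h
  · obtain ⟨s, rfl⟩ : ∃ s : Sym (Fin 4) n, s.1 = m := ⟨⟨m, h⟩, rfl⟩
    refine polyFil_mono ?_ (hd s)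
    have := Finset.single_le_sum (f := f) (fun s _ => by positivity) (Finset.mem_univ s)
    simp only [hf] at this ⊢
    linarith
  · exact zero_mem _

/-- Solutions in all degrees fit together. -/
theorem glue (s : ℕ → Sec) : ∃ u : Sec, ∀ A, ∀ v : Sec,
    (∀ n, opP A • s n = cutoff n v) → opP A • u = v := by
  -- P_A lowers the degree by one, so degree n + 1 of u must come from the solution for degree n.
  -- The truncated subtraction at the empty multiset is harmless, as no P_A reads that value.
  refine ⟨fun m => s (m.card - 1) m, fun A v h => ?_⟩
  funext m
  have := congrFun (h m.card) m
  rw [opP_smul] at this ⊢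
  simp only [Multiset.card_cons, Nat.add_sub_cancel]
  rw [this, cutoff, if_pos rfl]

theorem cutoff_zero_right (n : ℕ) : cutoff n 0 = 0 := by
  funext m
  simp [cutoff]

theorem opP_smul_cutoff_of_smul_eq_zero {A : Fin 4} {c : Sec} (h : opP A • c = 0) (n : ℕ) :
    opP A • cutoff n c = 0 := by
  cases n with
  | zero => exact opP_smul_cutoff_zero A c
  | succ n => rw [opP_smul_cutoff, h, cutoff_zero_right]

/-- Each degree of v lies in some step of the filtration, where the leading-term method applies;
`glue` then assembles the solutions. The signs make the leading coefficients of -P₀, -P₁, P₂ equal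
to 1. -/
theorem coregular_opP : Coregular₃ Sec opP := by
  have c01 := smul_rightInv_comm (j := 2) (j' := 3) (by decide) (i := 3) (i' := 2) (by decide)
  have c02 := smul_rightInv_comm (j := 2) (j' := 1) (by decide) (i := 3) (i' := 0) (by decide)
  have c12 := smul_rightInv_comm (j := 3) (j' := 1) (by decide) (i := 2) (i' := 0) (by decide)
  have neg_eq : ∀ {A : Fin 4} {c : Sec}, -opP A • c = 0 ↔ opP A • c = 0 := fun {A c} => by
    rw [neg_smul, neg_eq_zero]
  refine ⟨⟨fun v => ?_, fun v h0 => ?_⟩, fun v h0 h1 => ?_⟩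
  · have : ∀ n, ∃ u : Sec, opP 0 • u = cutoff n v := fun n => by
      obtain ⟨N, hN⟩ := exists_cutoff_mem_secFil n v
      obtain ⟨u, -, hu⟩ := solve_first secFil_mono secFil_eq_bot leadingInverse_zero N _ hN
      exact ⟨-u, by rw [← hu]; module⟩
    choose s hs using this
    obtain ⟨u, hu⟩ := glue s
    exact ⟨u, hu 0 v hs⟩
  · have : ∀ n, ∃ u : Sec, opP 0 • u = 0 ∧ opP 1 • u = cutoff n v := fun n => by
      obtain ⟨N, hN⟩ := exists_cutoff_mem_secFil n v
      obtain ⟨u, -, hu0, hu⟩ := solve_second secFil_mono secFil_eq_bot leadingInverse_zero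
        leadingInverse_one (rightInv_add _ _) c01 N _ hN
        (neg_eq.2 (opP_smul_cutoff_of_smul_eq_zero h0 n))
      exact ⟨-u, by rw [smul_neg, neg_eq.1 hu0, neg_zero], by rw [← hu]; module⟩
    choose s hs0 hs using this
    obtain ⟨u, hu⟩ := glue s
    exact ⟨u, hu 0 0 fun n => by rw [hs0, cutoff_zero_right], hu 1 v hs⟩
  · have : ∀ n, ∃ u : Sec, opP 0 • u = 0 ∧ opP 1 • u = 0 ∧ opP 2 • u = cutoff n v := fun n => by
      obtain ⟨N, hN⟩ := exists_cutoff_mem_secFil n v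
      obtain ⟨u, -, hu0, hu1, hu⟩ := solve_third secFil_mono secFil_eq_bot leadingInverse_zero
        leadingInverse_one leadingInverse_two (rightInv_add _ _) (rightInv_add _ _) c01 c02 c12
        N _ hN (neg_eq.2 (opP_smul_cutoff_of_smul_eq_zero h0 n))
        (neg_eq.2 (opP_smul_cutoff_of_smul_eq_zero h1 n))
      exact ⟨u, neg_eq.1 hu0, neg_eq.1 hu1, hu⟩
    choose s hs0 hs1 hs using this
    obtain ⟨u, hu⟩ := glue s
    exact ⟨u, hu 0 0 fun n => by rw [hs0, cutoff_zero_right],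
      hu 1 0 fun n => by rw [hs1, cutoff_zero_right], hu 2 v hs⟩

/-! ### Coregularity of T and the Poincaré lemma -/

/-- A right inverse of the shift `T_i`. -/
def unshift (i : Fin 4) (c : Sec) : Sec := fun m => if i ∈ m then c (m.erase i) else 0

theorem opT_smul_unshift (i : Fin 4) (c : Sec) : opT i • unshift i c = c := by
  funext m
  rw [opT_smul, unshift, if_pos (Multiset.mem_cons_self i m), Multiset.erase_cons_head]

theorem opT_smul_unshift_eq_zero {i j : Fin 4} (hij : i ≠ j) {c : Sec} (hc : opT i • c = 0) :
    opT i • unshift j c = 0 := by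
  funext m
  simp only [opT_smul, unshift, Multiset.mem_cons, hij.symm, false_or]
  split_ifs with h
  · rw [Multiset.erase_cons_tail _ hij]
    exact congrFun hc _
  · rfl

theorem coregular_opT : Coregular₃ Sec opT :=
  ⟨⟨fun v => ⟨_, opT_smul_unshift 0 v⟩,
    fun v h0 => ⟨_, opT_smul_unshift_eq_zero (by decide) h0, opT_smul_unshift 1 v⟩⟩,
    fun v h0 h1 => ⟨_, opT_smul_unshift_eq_zero (by decide) h0,
      opT_smul_unshift_eq_zero (by decide) h1, opT_smul_unshift 2 v⟩⟩

/-- The Poincaré lemma for one-forms. -/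
theorem exists_potential (g : Fin 4 → Sec) (hg : ∀ i j, opT i • g j = opT j • g i) :
    ∃ G : Sec, ∀ i, opT i • G = g i := by
  classical
  -- G at m is g_i at m with one i removed, for an arbitrary i in m; closedness makes the choice
  -- immaterial. The value at the empty multiset is free, since no T_i sees it.
  refine ⟨fun m => if h : ∃ i, i ∈ m then g h.choose (m.erase h.choose) else 0, fun i => ?_⟩
  funext m
  have h : ∃ j, j ∈ i ::ₘ m := ⟨i, Multiset.mem_cons_self i m⟩
  rw [opT_smul, dif_pos h]
  have hj := h.choose_spec
  generalize h.choose = j at hj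
  by_cases hij : j = i
  · rw [hij, Multiset.erase_cons_head]
  · obtain ⟨m', rfl⟩ := Multiset.exists_cons_of_mem ((Multiset.mem_cons.1 hj).resolve_left hij)
    rw [Multiset.cons_swap, Multiset.erase_cons_head]
    exact congrFun (hg i j) m'

/-! ### Linear coordinates adapted to ∇ -/

/-- The coefficients of the linear coordinates on `ℂ⁶` that are dual to the vector fields
`∇^{AB}`, `A < B`. -/
def coordCoeff : Fin 6 → Fin 6 → ℂ :=
  ![![-Complex.I / 2, 0, 0, 0, 0, 1 / 2], ![0, 0, 0, 1 / 2, -Complex.I / 2, 0],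
    ![0, 1 / 2, -Complex.I / 2, 0, 0, 0], ![0, 1 / 2, Complex.I / 2, 0, 0, 0],
    ![0, 0, 0, -1 / 2, -Complex.I / 2, 0], ![Complex.I / 2, 0, 0, 0, 0, 1 / 2]]

/-- The coefficients of the inverse change of coordinates. -/
def coordCoeffInv : Fin 6 → Fin 6 → ℂ :=
  ![![Complex.I, 0, 0, 0, 0, -Complex.I], ![0, 0, 1, 1, 0, 0],
    ![0, 0, Complex.I, -Complex.I, 0, 0], ![0, 1, 0, 0, -1, 0],
    ![0, Complex.I, 0, 0, Complex.I, 0], ![1, 0, 0, 0, 0, 1]]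

/-- The linear substitution with given coefficients. -/
def linSubst (L : Fin 6 → Fin 6 → ℂ) : Poly →ₐ[ℂ] Poly :=
  MvPolynomial.aeval fun k => ∑ j, MvPolynomial.C (L k j) * MvPolynomial.X j

theorem linSubst_X (L : Fin 6 → Fin 6 → ℂ) (k : Fin 6) :
    linSubst L (MvPolynomial.X k) = ∑ j, MvPolynomial.C (L k j) * MvPolynomial.X j := by
  simp [linSubst]

theorem linSubst_comp {L L' : Fin 6 → Fin 6 → ℂ}
    (h : ∀ i k, ∑ j, L i j * L' j k = if i = k then 1 else 0) (ψ : Poly) :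
    linSubst L' (linSubst L ψ) = ψ := by
  have : (linSubst L').comp (linSubst L) = AlgHom.id ℂ Poly := by
    refine MvPolynomial.algHom_ext fun i => ?_
    rw [AlgHom.comp_apply, linSubst_X, map_sum, AlgHom.id_apply]
    have e : ∀ j, linSubst L' (MvPolynomial.C (L i j) * MvPolynomial.X j) =
        ∑ k, MvPolynomial.C (L i j * L' j k) * MvPolynomial.X k := fun j => by
      rw [map_mul, linSubst_X, Finset.mul_sum, MvPolynomial.algHom_C]
      exact Finset.sum_congr rfl fun k _ => by
        rw [MvPolynomial.C_mul, mul_assoc]; rfl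
    simp only [e]
    rw [Finset.sum_comm]
    simp only [← Finset.sum_mul, ← map_sum, h]
    simp
  exact DFunLike.congr_fun this ψ

theorem pderiv_linSubst (L : Fin 6 → Fin 6 → ℂ) (j : Fin 6) (ψ : Poly) :
    MvPolynomial.pderiv j (linSubst L ψ) =
      ∑ k, MvPolynomial.C (L k j) * linSubst L (MvPolynomial.pderiv k ψ) := by
  induction ψ using MvPolynomial.induction_on with
  | C a => simp [MvPolynomial.algHom_C, MvPolynomial.algebraMap_eq]
  | add p q hp hq => simp only [map_add, hp, hq, mul_add, Finset.sum_add_distrib]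
  | mul_X p i hp =>
    classical
    have hX : MvPolynomial.pderiv j (linSubst L (MvPolynomial.X i)) = MvPolynomial.C (L i j) := by
      simp [linSubst_X, MvPolynomial.pderiv_X, Pi.single_apply]
    simp only [map_mul, MvPolynomial.pderiv_mul, hp, hX, map_add, mul_add,
      Finset.sum_add_distrib, Finset.sum_mul, mul_assoc]
    congr 1
    simp [MvPolynomial.pderiv_X, Pi.single_apply, mul_comm]

/-- The function on `ℝ⁶` of a polynomial in the coordinates dual to `∇^{AB}`. -/
def ev (ψ : Poly) (x : E6) : ℂ :=
  MvPolynomial.eval (fun i => ((x i : ℝ) : ℂ)) (linSubst coordCoeff ψ)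

theorem ev_add (ψ χ : Poly) (x : E6) : ev (ψ + χ) x = ev ψ x + ev χ x := by simp [ev]

theorem ev_zero (x : E6) : ev 0 x = 0 := by simp [ev]

theorem ev_zsmul (n : ℤ) (ψ : Poly) (x : E6) : ev (n • ψ) x = n * ev ψ x := by
  simp [ev]

theorem ev_sum {ι : Type*} (s : Finset ι) (ψ : ι → Poly) (x : E6) :
    ev (∑ i ∈ s, ψ i) x = ∑ i ∈ s, ev (ψ i) x := by simp [ev]

theorem coord_inv_left (i k : Fin 6) :
    ∑ j, coordCoeff i j * coordCoeffInv j k = if i = k then 1 else 0 := by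
  have hI : Complex.I * Complex.I = -1 := Complex.I_mul_I
  fin_cases i <;> fin_cases k <;>
    simp [coordCoeff, coordCoeffInv, Fin.sum_univ_six] <;>
    first
    | ring1
    | linear_combination (1 / 2 : ℂ) * hI
    | linear_combination (-1 / 2 : ℂ) * hI

theorem coord_inv_right (i k : Fin 6) :
    ∑ j, coordCoeffInv i j * coordCoeff j k = if i = k then 1 else 0 := by
  have hI : Complex.I * Complex.I = -1 := Complex.I_mul_I
  fin_cases i <;> fin_cases k <;>
    simp [coordCoeff, coordCoeffInv, Fin.sum_univ_six] <;>
    first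
    | ring1
    | linear_combination (1 / 2 : ℂ) * hI
    | linear_combination (-1 / 2 : ℂ) * hI
    | linear_combination -hI

/-- A complex polynomial vanishing at all real points is zero, and the substitution is invertible.
-/
theorem eq_zero_of_ev_eq_zero {ψ : Poly} (h : ∀ x, ev ψ x = 0) : ψ = 0 := by
  have h0 : linSubst coordCoeff ψ = 0 := by
    refine MvPolynomial.funext_set (fun _ : Fin 6 => Set.range ((↑) : ℝ → ℂ))
      (fun _ => Set.infinite_range_of_injective Complex.ofReal_injective) fun z hz => ?_
    choose y hy using fun i => hz i trivial
    have := h (WithLp.toLp 2 y)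
    simp only [ev, hy] at this
    rw [this, map_zero]
  rw [← linSubst_comp coord_inv_left ψ, h0, map_zero]

theorem isPoly_ev (ψ : Poly) : IsPoly (ev ψ) := ⟨_, fun _ => rfl⟩

theorem IsPoly.exists_ev {g : E6 → ℂ} (hg : IsPoly g) : ∃ ψ, ∀ x, ev ψ x = g x := by
  obtain ⟨φ, hφ⟩ := hg
  refine ⟨linSubst coordCoeffInv φ, fun x => ?_⟩
  rw [ev, linSubst_comp coord_inv_right, hφ]

/-- By the chain rule; the coordinates are dual to the six fields ∇^{AB}, A < B, so each becomes a
single partial derivative. -/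
theorem nabla_ev (A B : Fin 4) (ψ : Poly) (x : E6) :
    nabla A B (ev ψ) x = ev (polyNabla A B ψ) x := by
  have h : ∀ j, pd j (ev ψ) x =
      ∑ k, coordCoeff k j * ev (MvPolynomial.pderiv k ψ) x := fun j => by
    have := pd_eval j (linSubst coordCoeff ψ) x
    rw [pderiv_linSubst] at this
    refine this.trans ?_
    simp [ev]
  have ev_neg : ∀ χ, ev (-χ) x = -ev χ x := fun χ => by simp [ev]
  have hI : Complex.I ^ 2 = -1 := Complex.I_sq
  simp only [nabla, h, Fin.sum_univ_six]
  fin_cases A <;> fin_cases B <;>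
    simp [iota, coordCoeff, polyNabla, ev_neg, ev_zero] <;>
    ring_nf <;> simp [hI] <;> ring

/-! ### Tensor fields as alternating families in `Sec` -/

/-- The multiset of the values of a tuple. -/
def vals {p : ℕ} (B : Fin p → Fin 4) : Multiset (Fin 4) := (List.ofFn B : List (Fin 4))

theorem card_vals {p : ℕ} (B : Fin p → Fin 4) : (vals B).card = p := by simp [vals]

theorem vals_cons {p : ℕ} (b : Fin 4) (B : Fin p → Fin 4) :
    vals (Fin.cons b B : Fin (p + 1) → Fin 4) = b ::ₘ vals B := by
  simp [vals, List.ofFn_succ]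

theorem vals_comp_perm {p : ℕ} (B : Fin p → Fin 4) (τ : Equiv.Perm (Fin p)) :
    vals (fun i => B (τ i)) = vals B :=
  Multiset.coe_eq_coe.2 (τ.ofFn_comp_perm B)

theorem vals_snoc {p : ℕ} (b : Fin 4) (B : Fin p → Fin 4) :
    vals (Fin.snoc B b : Fin (p + 1) → Fin 4) = b ::ₘ vals B := by
  rw [← vals_cons, ← vals_comp_perm (Fin.cons b B : Fin (p + 1) → Fin 4) (finRotate (p + 1))]
  congr 1
  funext i
  rw [Fin.snoc_eq_cons_rotate]

theorem exists_vals_eq {p : ℕ} {m : Multiset (Fin 4)} (hm : m.card = p) :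
    ∃ B : Fin p → Fin 4, vals B = m := by
  induction m using Quotient.inductionOn with
  | h l =>
    subst hm
    exact ⟨l.get, congrArg _ (List.ofFn_get l)⟩

/-- Both tuples have the same sorted rearrangement. -/
theorem exists_perm_of_vals_eq {p : ℕ} {B B' : Fin p → Fin 4} (h : vals B = vals B') :
    ∃ σ τ : Equiv.Perm (Fin p), (fun i => B (σ i)) = fun i => B' (τ i) := by
  refine ⟨Tuple.sort B, Tuple.sort B', List.ofFn_injective ?_⟩
  have hp : (List.ofFn (B ∘ Tuple.sort B)).Perm (List.ofFn (B' ∘ Tuple.sort B')) :=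
    (((Tuple.sort B).ofFn_comp_perm B).trans (Multiset.coe_eq_coe.1 h)).trans
      ((Tuple.sort B').ofFn_comp_perm B').symm
  exact hp.eq_of_pairwise' (Tuple.monotone_sort B).sortedLE_ofFn.pairwise
    (Tuple.monotone_sort B').sortedLE_ofFn.pairwise

/-- The family `c` has only components of degree `p`. -/
def IsHomog (p : ℕ) (c : Sec) : Prop := ∀ m, m.card ≠ p → c m = 0

theorem IsHomog.eq_zero {p : ℕ} {c : Sec} (hc : IsHomog p c)
    (h : ∀ (B : Fin p → Fin 4) x, ev (c (vals B)) x = 0) : c = 0 := by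
  funext m
  by_cases hm : m.card = p
  · obtain ⟨B, rfl⟩ := exists_vals_eq hm
    exact eq_zero_of_ev_eq_zero (h B)
  · exact hc m hm

theorem IsHomog.add {p : ℕ} {c d : Sec} (hc : IsHomog p c) (hd : IsHomog p d) :
    IsHomog p (c + d) := fun m hm => by
  rw [Pi.add_apply, hc m hm, hd m hm, add_zero]

theorem IsHomog.zsmul {p : ℕ} {c : Sec} (hc : IsHomog p c) (n : ℤ) : IsHomog p (n • c) :=
  fun m hm => by rw [Pi.smul_apply, hc m hm, smul_zero]

theorem IsHomog.sum {p : ℕ} {ι : Type*} (s : Finset ι) {c : ι → Sec}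
    (hc : ∀ i ∈ s, IsHomog p (c i)) : IsHomog p (∑ i ∈ s, c i) := fun m hm => by
  rw [Finset.sum_apply]
  exact Finset.sum_eq_zero fun i hi => hc i hi m hm

theorem IsHomog.opT_smul {p : ℕ} {c : Sec} (hc : IsHomog (p + 1) c) (i : Fin 4) :
    IsHomog p (opT i • c) := fun m hm => hc _ (by simpa using hm)

theorem IsHomog.opP_smul {p : ℕ} {c : Sec} (hc : IsHomog (p + 1) c) (A : Fin 4) :
    IsHomog p (opP A • c) := fun m hm => by
  rw [KMonogenic.opP_smul]
  exact Finset.sum_eq_zero fun B _ => by rw [hc _ (by simpa using hm), map_zero]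

theorem IsHomog.cutoff_eq {p : ℕ} {c : Sec} (hc : IsHomog p c) : cutoff p c = c := by
  funext m
  by_cases hm : m.card = p
  · simp [cutoff, hm]
  · simp [cutoff, hm, hc m hm]

/-- The tensor field of degree `p` of a family of sections that is indexed by the upper indices. -/
def toField (p : ℕ) {q : ℕ} (c : (Fin q → Fin 4) → Sec) : E6 → Tensor p q :=
  fun x A B => ev (c A (vals B)) x

theorem exists_toField_eq {p q : ℕ} {f : E6 → Tensor p q} (hf : f ∈ polyV p q) :
    ∃ c : (Fin q → Fin 4) → Sec, (∀ A, IsHomog p (c A)) ∧ toField p c = f := by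
  classical
  choose ψ hψ using fun A B => (hf.2 A B).exists_ev
  refine ⟨fun A m => if h : ∃ B : Fin p → Fin 4, vals B = m then ψ A h.choose else 0,
    fun A m hm => dif_neg ?_, ?_⟩
  · rintro ⟨B, rfl⟩
    exact hm (card_vals B)
  · funext x A B
    have h : ∃ B' : Fin p → Fin 4, vals B' = vals B := ⟨B, rfl⟩
    simp only [toField, dif_pos h, hψ]
    obtain ⟨σ, τ, hστ⟩ := exists_perm_of_vals_eq h.choose_spec
    have hs := (calV_le_symAlt _ _ (hf.1 x)).1
    rw [← hs A h.choose σ, hστ, hs A B τ]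

theorem toField_eq_zero {p q : ℕ} {c : (Fin q → Fin 4) → Sec} (hc : ∀ A, IsHomog p (c A))
    (h : toField p c = 0) (A : Fin q → Fin 4) : c A = 0 :=
  (hc A).eq_zero fun B x => congrFun (congrFun (congrFun h x) A) B

/-- The antisymmetrization of `P ∧ c`, without the factor `1 / (q + 1)!`. -/
def wedge {q : ℕ} (c : (Fin q → Fin 4) → Sec) (A : Fin (q + 1) → Fin 4) : Sec :=
  ∑ σ : Equiv.Perm (Fin (q + 1)),
    (Equiv.Perm.sign σ : ℤ) • (opP (A (σ 0)) • c (fun i => A (σ i.succ)))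

theorem diffOp_toField (p : ℕ) {q : ℕ} (c : (Fin q → Fin 4) → Sec) :
    diffOp p q (toField (p + 1) c) =
      ((q + 1).factorial : ℂ)⁻¹ • toField p (wedge c) := by
  funext x A B
  simp only [diffOp, Pi.smul_apply, smul_eq_mul, toField, wedge, Finset.sum_apply, ev_sum,
    ev_zsmul, opP_smul, vals_cons, nabla_ev]

theorem wedge_zero (c : (Fin 0 → Fin 4) → Sec) (A : Fin 1 → Fin 4) :
    wedge c A = opP (A 0) • c Fin.elim0 := by
  have h : (Finset.univ : Finset (Equiv.Perm (Fin 1))) = {1} := by decide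
  have e : (fun i : Fin 0 => A ((1 : Equiv.Perm (Fin 1)) i.succ)) = Fin.elim0 :=
    Subsingleton.elim _ _
  rw [wedge, h, Finset.sum_singleton, e]
  simp

theorem wedge_one (c : (Fin 1 → Fin 4) → Sec) (A : Fin 2 → Fin 4) :
    wedge c A = opP (A 0) • c (fun _ => A 1) - opP (A 1) • c (fun _ => A 0) := by
  have h : (Finset.univ : Finset (Equiv.Perm (Fin 2))) = {1, Equiv.swap 0 1} := by decide
  have e1 : (fun i : Fin 1 => A ((1 : Equiv.Perm (Fin 2)) i.succ)) = fun _ => A 1 := by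
    funext i; fin_cases i; rfl
  have e2 : (fun i : Fin 1 => A (Equiv.swap (0 : Fin 2) 1 i.succ)) = fun _ => A 0 := by
    funext i; fin_cases i; rfl
  rw [wedge, h, Finset.sum_pair (by decide), e1, e2]
  simp [sub_eq_add_neg]

theorem wedge_two (c : (Fin 2 → Fin 4) → Sec) (A : Fin 3 → Fin 4) :
    wedge c A = opP (A 0) • c ![A 1, A 2] - opP (A 1) • c ![A 0, A 2] - opP (A 2) • c ![A 1, A 0]
      - opP (A 0) • c ![A 2, A 1] + opP (A 1) • c ![A 2, A 0] + opP (A 2) • c ![A 0, A 1] := by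
  have h : (Finset.univ : Finset (Equiv.Perm (Fin 3))) =
      {1, Equiv.swap 0 1, Equiv.swap 0 2, Equiv.swap 1 2, Equiv.swap 0 1 * Equiv.swap 1 2,
        Equiv.swap 1 2 * Equiv.swap 0 1} := by decide
  have key : ∀ (σ : Equiv.Perm (Fin 3)) (a b : Fin 3), σ 1 = a → σ 2 = b →
      (fun i : Fin 2 => A (σ i.succ)) = ![A a, A b] := by
    rintro σ _ _ rfl rfl
    funext i
    fin_cases i <;> rfl
  rw [wedge, h, Finset.sum_insert (by decide), Finset.sum_insert (by decide),
    Finset.sum_insert (by decide), Finset.sum_insert (by decide), Finset.sum_pair (by decide),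
    key 1 1 2 (by decide) (by decide), key (Equiv.swap 0 1) 0 2 (by decide) (by decide),
    key (Equiv.swap 0 2) 1 0 (by decide) (by decide),
    key (Equiv.swap 1 2) 2 1 (by decide) (by decide),
    key (Equiv.swap 0 1 * Equiv.swap 1 2) 2 0 (by decide) (by decide),
    key (Equiv.swap 1 2 * Equiv.swap 0 1) 0 1 (by decide) (by decide)]
  have s1 : Equiv.swap (0 : Fin 3) 1 0 = 1 := by decide
  have s2 : Equiv.swap (0 : Fin 3) 2 0 = 2 := by decide
  have s3 : Equiv.swap (1 : Fin 3) 2 0 = 0 := by decide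
  have s4 : (Equiv.swap 0 1 * Equiv.swap 1 2 : Equiv.Perm (Fin 3)) 0 = 1 := by decide
  have s5 : (Equiv.swap 1 2 * Equiv.swap 0 1 : Equiv.Perm (Fin 3)) 0 = 2 := by decide
  have t1 : Equiv.Perm.sign (Equiv.swap (0 : Fin 3) 1) = -1 := by decide
  have t2 : Equiv.Perm.sign (Equiv.swap (0 : Fin 3) 2) = -1 := by decide
  have t3 : Equiv.Perm.sign (Equiv.swap (1 : Fin 3) 2) = -1 := by decide
  have t4 : Equiv.Perm.sign (Equiv.swap 0 1 * Equiv.swap 1 2 : Equiv.Perm (Fin 3)) = 1 := by decide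
  have t5 : Equiv.Perm.sign (Equiv.swap 1 2 * Equiv.swap 0 1 : Equiv.Perm (Fin 3)) = 1 := by decide
  rw [s1, s2, s3, s4, s5, t1, t2, t3, t4, t5]
  simp only [Equiv.Perm.sign_one, Equiv.Perm.coe_one, id_eq, Units.val_one, Units.val_neg,
    one_smul, neg_smul]
  abel

theorem IsHomog.wedge {p q : ℕ} {c : (Fin q → Fin 4) → Sec} (hc : ∀ A, IsHomog (p + 1) (c A))
    (A : Fin (q + 1) → Fin 4) : IsHomog p (wedge c A) :=
  IsHomog.sum _ fun _ _ => ((hc _).opP_smul _).zsmul _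

theorem wedge_eq_zero {p q : ℕ} {c : (Fin q → Fin 4) → Sec} (hc : ∀ A, IsHomog (p + 1) (c A))
    (h : diffOp p q (toField (p + 1) c) = 0) (A : Fin (q + 1) → Fin 4) : wedge c A = 0 := by
  refine toField_eq_zero (p := p) (IsHomog.wedge hc) ?_ A
  rw [diffOp_toField] at h
  refine (smul_eq_zero.1 h).resolve_left (inv_ne_zero ?_)
  exact_mod_cast Nat.factorial_ne_zero _

theorem diffOp_toField_eq {p q : ℕ} {c : (Fin q → Fin 4) → Sec} {d : (Fin (q + 1) → Fin 4) → Sec}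
    (h : ∀ A, wedge c A = ((q + 1).factorial : ℤ) • d A) :
    diffOp p q (toField (p + 1) c) = toField p d := by
  rw [diffOp_toField]
  funext x A B
  have h0 : ((q + 1).factorial : ℂ) ≠ 0 := by exact_mod_cast Nat.factorial_ne_zero _
  simp only [Pi.smul_apply, toField, h, ev_zsmul, smul_eq_mul]
  push_cast
  rw [inv_mul_cancel_left₀ h0]

/-- Homogeneity makes the family determined by its tensor field, so pointwise antisymmetry lifts to
an identity in `Sec`. -/
theorem family_perm {p q : ℕ} {c : (Fin q → Fin 4) → Sec} (hc : ∀ A, IsHomog p (c A))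
    (hf : toField p c ∈ polyV p q) (A : Fin q → Fin 4) (σ : Equiv.Perm (Fin q)) :
    c (fun i => A (σ i)) = (Equiv.Perm.sign σ : ℤ) • c A := by
  rw [← sub_eq_zero, sub_eq_add_neg, ← neg_smul]
  refine ((hc _).add ((hc A).zsmul _)).eq_zero fun B x => ?_
  have := (calV_le_symAlt _ _ (hf.1 x)).2 A B σ
  simp only [toField] at this
  rw [Pi.add_apply, Pi.smul_apply, ev_add, ev_zsmul, this]
  push_cast
  ring

theorem family_contr {p q : ℕ} {c : (Fin (q + 1) → Fin 4) → Sec}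
    (hc : ∀ A, IsHomog (p + 1) (c A)) (hf : toField (p + 1) c ∈ polyV (p + 1) (q + 1))
    (A : Fin q → Fin 4) : ∑ i, opT i • c (Fin.cons i A) = 0 := by
  refine (IsHomog.sum _ fun i _ => (hc _).opT_smul i).eq_zero fun B x => ?_
  have := congrFun (congrFun (LinearMap.mem_ker.1 (hf.1 x).2) A) B
  simp only [contraction, LinearMap.coe_mk, AddHom.coe_mk, toField, vals_snoc] at this
  rw [Finset.sum_apply, ev_sum]
  exact this

theorem toField_mem_symAlt {p q : ℕ} {c : (Fin q → Fin 4) → Sec}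
    (hσ : ∀ A (σ : Equiv.Perm (Fin q)), c (fun i => A (σ i)) = (Equiv.Perm.sign σ : ℤ) • c A)
    (x : E6) : toField p c x ∈ symAlt p q := by
  refine ⟨fun A B τ => ?_, fun A B σ => ?_⟩
  · simp only [toField, vals_comp_perm]
  · simp only [toField, hσ, Pi.smul_apply, ev_zsmul]

theorem toField_mem_polyV_zero {p : ℕ} (c : (Fin 0 → Fin 4) → Sec) :
    toField (p + 1) c ∈ polyV (p + 1) 0 := by
  refine ⟨fun x => toField_mem_symAlt (fun A σ => ?_) x, fun A B => isPoly_ev _⟩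
  rw [Subsingleton.elim σ 1]
  simp

theorem toField_mem_polyV {p q : ℕ} {c : (Fin (q + 1) → Fin 4) → Sec}
    (hσ : ∀ A (σ : Equiv.Perm (Fin (q + 1))),
      c (fun i => A (σ i)) = (Equiv.Perm.sign σ : ℤ) • c A)
    (hC : ∀ A : Fin q → Fin 4, ∑ i, opT i • c (Fin.cons i A) = 0) :
    toField (p + 1) c ∈ polyV (p + 1) (q + 1) := by
  refine ⟨fun x => ⟨toField_mem_symAlt hσ x, LinearMap.mem_ker.2 ?_⟩, fun A B => isPoly_ev _⟩
  funext A B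
  have := congrArg (fun ψ => ev ψ x) (congrFun (hC A) (vals B))
  simp only [Finset.sum_apply, ev_sum, Pi.zero_apply, ev_zero] at this
  simp only [contraction, LinearMap.coe_mk, AddHom.coe_mk, toField, vals_snoc]
  exact this

theorem self_eq_neg_sec {c : Sec} (h : c = -c) : c = 0 := by
  funext m
  exact self_eq_neg.1 (congrFun h m)

theorem family_two_swap {p : ℕ} {c : (Fin 2 → Fin 4) → Sec} (hc : ∀ A, IsHomog p (c A))
    (hf : toField p c ∈ polyV p 2) (i j : Fin 4) : c ![i, j] = -c ![j, i] := by
  have h := family_perm hc hf ![j, i] (Equiv.swap 0 1)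
  have e : (fun k => (![j, i] : Fin 2 → Fin 4) (Equiv.swap 0 1 k)) = ![i, j] := by
    funext k; fin_cases k <;> simp
  rw [e] at h
  simpa using h

theorem family_three_swap {p : ℕ} {c : (Fin 3 → Fin 4) → Sec} (hc : ∀ A, IsHomog p (c A))
    (hf : toField p c ∈ polyV p 3) (i j k : Fin 4) :
    c ![i, j, k] = -c ![j, i, k] ∧ c ![i, j, k] = -c ![i, k, j] := by
  have h := family_perm hc hf ![j, i, k] (Equiv.swap 0 1)
  have h' := family_perm hc hf ![i, k, j] (Equiv.swap 1 2)
  have e : (fun l => (![j, i, k] : Fin 3 → Fin 4) (Equiv.swap 0 1 l)) = ![i, j, k] := by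
    funext l; fin_cases l <;> rfl
  have e' : (fun l => (![i, k, j] : Fin 3 → Fin 4) (Equiv.swap 1 2 l)) = ![i, j, k] := by
    funext l; fin_cases l <;> rfl
  rw [e, Equiv.Perm.sign_swap (by decide)] at h
  rw [e', Equiv.Perm.sign_swap (by decide)] at h'
  exact ⟨by simpa using h, by simpa using h'⟩

theorem toField_mem_polyV_one {p : ℕ} {u : Fin 4 → Sec} (hC : ∑ i, opT i • u i = 0) :
    toField (p + 1) (fun A : Fin 1 → Fin 4 => u (A 0)) ∈ polyV (p + 1) 1 := by
  refine toField_mem_polyV (fun A σ => ?_) fun A => by simpa using hC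
  obtain rfl : σ = 1 := Subsingleton.elim (α := Equiv.Perm (Fin 1)) σ 1
  simp

theorem toField_mem_polyV_two {p : ℕ} {w : Fin 4 → Fin 4 → Sec} (hw : ∀ i j, w i j = -w j i)
    (hC : ∀ j, ∑ i, opT i • w i j = 0) :
    toField (p + 1) (fun A : Fin 2 → Fin 4 => w (A 0) (A 1)) ∈ polyV (p + 1) 2 := by
  refine toField_mem_polyV (fun A σ => ?_) fun A => by simpa using hC (A 0)
  have h : σ ∈ ({1, Equiv.swap 0 1} : Finset (Equiv.Perm (Fin 2))) := by
    revert σ; decide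
  rw [Finset.mem_insert, Finset.mem_singleton] at h
  rcases h with rfl | rfl
  · simp
  · simpa using hw (A 1) (A 0)

/-! ### Exactness of the polynomial complex -/

theorem exact_polyD_zero (p : ℕ) :
    Function.Exact (polyD (p + 1) 0) (polyD p 1) := by
  intro f
  obtain ⟨c, hc, hcf⟩ := exists_toField_eq f.2
  have hf : toField (p + 1) c ∈ polyV (p + 1) 1 := hcf ▸ f.2
  constructor
  · intro h
    have hD : diffOp p 1 (toField (p + 1) c) = 0 := hcf ▸ congrArg Subtype.val h
    obtain ⟨φ, hφ⟩ := exact_at_one opP_opT coregular_opT.1 coregular_opP exists_potential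
      (fun i => c fun _ => i) (by
        have h := family_contr hc hf Fin.elim0
        refine (Finset.sum_congr rfl fun i _ => ?_).trans h
        congr 2
        funext k
        fin_cases k
        rfl) (fun i j => by
        have h := wedge_eq_zero hc hD ![i, j]
        rwa [wedge_one] at h)
    -- φ need not be homogeneous: `toField` reads only its degree p + 2.
    refine ⟨⟨toField (p + 2) fun _ => φ, toField_mem_polyV_zero _⟩, Subtype.ext ?_⟩
    change diffOp (p + 1) 0 (toField (p + 2) fun _ => φ) = f.1
    rw [← hcf]
    refine diffOp_toField_eq fun A => ?_
    rw [wedge_zero, ← hφ]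
    have e : A = fun _ => A 0 := by
      funext k
      fin_cases k
      rfl
    rw [← e]
    simp
  · rintro ⟨g, rfl⟩
    obtain ⟨d, -, hdg⟩ := exists_toField_eq g.2
    refine Subtype.ext ?_
    change diffOp p 1 (diffOp (p + 1) 0 g.1) = 0
    rw [← hdg, diffOp_toField_eq (d := wedge d) fun A => by simp, diffOp_toField]
    have h : wedge (wedge d) = 0 := by
      funext A
      rw [wedge_one, wedge_zero, wedge_zero, Pi.zero_apply]
      module
    rw [h]
    refine smul_eq_zero_of_right _ ?_
    funext x A B
    exact ev_zero x

theorem exact_polyD_one (p : ℕ) :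
    Function.Exact (polyD (p + 1) 1) (polyD p 2) := by
  intro f
  obtain ⟨c, hc, hcf⟩ := exists_toField_eq f.2
  have hf : toField (p + 1) c ∈ polyV (p + 1) 2 := hcf ▸ f.2
  have hw := family_two_swap hc hf
  have hw0 : ∀ i, c ![i, i] = 0 := fun i => self_eq_neg_sec (hw i i)
  have eta : ∀ A : Fin 2 → Fin 4, A = ![A 0, A 1] := fun A => by
    funext k
    fin_cases k <;> rfl
  constructor
  · intro h
    have hD : diffOp p 2 (toField (p + 1) c) = 0 := hcf ▸ congrArg Subtype.val h
    have hD' : ∀ i j k, opP i • c ![j, k] + opP j • c ![k, i] + opP k • c ![i, j] = 0 := by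
      intro i j k
      have h := wedge_eq_zero hc hD ![i, j, k]
      rw [wedge_two] at h
      simp only [Matrix.cons_val] at h
      rw [hw i k, hw j i, hw k j] at h
      -- The sum over six permutations contains each cyclic term twice.
      have h2 : ∀ y : Sec, y + y = 0 → y = 0 := fun y hy =>
        self_eq_neg_sec (eq_neg_of_add_eq_zero_left hy)
      refine h2 _ ?_
      rw [← h]
      module
    obtain ⟨v₁₂, v₁₃, v₂₃, hv⟩ := exists_isContr coregular_opT (fun i j => c ![i, j]) hw0 hw
      (fun j => by
        refine (Finset.sum_congr rfl fun i _ => ?_).trans (family_contr hc hf ![j])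
        rfl)
    have hz := hv.smul_eq_zero opP_opT hw hD'
    have cut_neg : ∀ n c, cutoff n (-c) = -cutoff n c := fun n c => by
      funext m
      by_cases hm : m.card = n <;> simp [cutoff, hm]
    have cut_add : ∀ n c d, cutoff n (c + d) = cutoff n c + cutoff n d := fun n c d => by
      funext m
      by_cases hm : m.card = n <;> simp [cutoff, hm]
    have cut_sub : ∀ n c d, cutoff n (c - d) = cutoff n c - cutoff n d := fun n c d => by
      rw [sub_eq_add_neg, cut_add, cut_neg, ← sub_eq_add_neg]
    -- As c is homogeneous of degree p + 1, only degree p + 2 of v matters, and truncating there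
    -- keeps c = ι_T v.
    have hv' : IsContr opT (fun i j => c ![i, j]) (cutoff (p + 2) v₁₂) (cutoff (p + 2) v₁₃)
        (cutoff (p + 2) v₂₃) := by
      obtain ⟨h1, h2, h3, h4, h5, h6⟩ := hv
      simp only [IsContr, opT_smul_cutoff, ← cut_neg, ← cut_add, ← cut_sub, ← h1, ← h2, ← h3,
        ← h4, ← h5, ← h6, (hc _).cutoff_eq, and_self]
    have hz' : -(opP 1 • cutoff (p + 2) v₂₃) + opP 2 • cutoff (p + 2) v₁₃ -
        opP 3 • cutoff (p + 2) v₁₂ = 0 := by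
      simp only [opP_smul_cutoff, ← cut_neg, ← cut_add, ← cut_sub]
      funext m
      -- After truncation the coefficient of P∧v lives in degree p + 1 ≥ 1, so it vanishes at the
      -- empty multiset; at i ::ₘ m it vanishes because T_i kills it.
      induction m using Multiset.induction with
      | empty => simp [cutoff]
      | cons i m _ =>
        simp only [cutoff]
        split_ifs
        · exact congrFun (hz i) m
        · rfl
    obtain ⟨u, hu, hwu⟩ := exact_at_two opP_opT coregular_opP.1 hw0 hw hv' hz'
    -- The factor 2 cancels the 1/2! of the antisymmetrization.
    refine ⟨⟨toField (p + 2) fun A => (2 : ℤ) • u (A 0),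
      toField_mem_polyV_one (u := fun i => (2 : ℤ) • u i) ?_⟩, Subtype.ext ?_⟩
    · rw [← smul_zero (2 : ℤ), ← hu, Finset.smul_sum]
      exact Finset.sum_congr rfl fun i _ => smul_comm _ _ _
    change diffOp (p + 1) 1 (toField (p + 2) fun A => (2 : ℤ) • u (A 0)) = f.1
    rw [← hcf]
    refine diffOp_toField_eq fun A => ?_
    rw [wedge_one, eta A, hwu]
    simp only [Matrix.cons_val, Nat.factorial]
    module
  · rintro ⟨g, hg⟩
    obtain ⟨d, -, hdg⟩ := exists_toField_eq g.2
    have h2 : ((2 : ℂ) • f).1 = toField (p + 1) (wedge d) := by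
      rw [← hg]
      change (2 : ℂ) • diffOp (p + 1) 1 g.1 = _
      rw [← hdg, diffOp_toField, smul_smul]
      norm_num
    have h : polyD p 2 ((2 : ℂ) • f) = 0 := by
      refine Subtype.ext ?_
      change diffOp p 2 ((2 : ℂ) • f).1 = 0
      rw [h2, diffOp_toField]
      have h : wedge (wedge d) = 0 := by
        funext A
        simp only [wedge_two, wedge_one, Matrix.cons_val, Pi.zero_apply]
        module
      rw [h]
      refine smul_eq_zero_of_right _ ?_
      funext x A B
      exact ev_zero x
    rw [map_smul] at h
    exact (smul_eq_zero.1 h).resolve_left two_ne_zero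

theorem surjective_polyD_two (p : ℕ) : Function.Surjective (polyD (p + 1) 2) := by
  intro f
  obtain ⟨c, hc, hcf⟩ := exists_toField_eq f.2
  have hf : toField (p + 1) c ∈ polyV (p + 1) 3 := hcf ▸ f.2
  have hs := family_three_swap hc hf
  have eta : ∀ A : Fin 3 → Fin 4, A = ![A 0, A 1, A 2] := fun A => by
    funext k
    fin_cases k <;> rfl
  obtain ⟨w, -, hw, hC, ht⟩ := exact_at_three opP_opT coregular_opP.1.1 exists_potential
    (fun i j k => c ![i, j, k]) (fun i j => self_eq_neg_sec (hs i i j).1)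
    (fun i j k => (hs i j k).1) (fun i j k => (hs i j k).2) (fun j k => family_contr hc hf ![j, k])
  -- For alternating w the antisymmetrized sum is twice the cyclic sum, so 3 supplies the rest of 3!
  -- = 6.
  refine ⟨⟨toField (p + 2) fun A => (3 : ℤ) • w (A 0) (A 1),
    toField_mem_polyV_two (w := fun i j => (3 : ℤ) • w i j) (fun i j => ?_) fun j => ?_⟩,
    Subtype.ext ?_⟩
  · rw [hw i j, smul_neg]
  · rw [← smul_zero (3 : ℤ), ← hC j, Finset.smul_sum]
    exact Finset.sum_congr rfl fun i _ => smul_comm _ _ _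
  change diffOp (p + 1) 2 (toField (p + 2) fun A => (3 : ℤ) • w (A 0) (A 1)) = f.1
  rw [← hcf]
  refine diffOp_toField_eq fun A => ?_
  rw [wedge_two, eta A, ht]
  simp only [Matrix.cons_val, Nat.factorial]
  rw [hw (A 0) (A 2), hw (A 1) (A 0), hw (A 2) (A 1)]
  module

end KMonogenic
end

theorem mainTheorem4 (k p : ℕ) (hk : 6 ≤ k) (hp : k = p + 3) :
    Function.Exact (KMonogenic.polyD (p + 2) 0) (KMonogenic.polyD (p + 1) 1) ∧
    Function.Exact (KMonogenic.polyD (p + 1) 1) (KMonogenic.polyD p 2) ∧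
    Function.Surjective (KMonogenic.polyD p 2) := by
  -- With p ≥ 1 even 𝒱₃ retains a lower index, so its elements satisfy the trace condition on which
  -- the chase relies.
  obtain ⟨r, rfl⟩ : ∃ r, p = r + 1 := ⟨p - 1, by omega⟩
  exact ⟨KMonogenic.exact_polyD_zero _, KMonogenic.exact_polyD_one _,
    KMonogenic.surjective_polyD_two r⟩
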